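/- Let $W\subset\mathbb R^d$ be a measurable domain of finite volume, let $N\ge 1$, and let $\Phi_a,\Phi_b:(\mathbb R^d)^N\to\mathbb R$ be measurable functions, symmetric in their $N$ arguments and square integrable on $W^N$, with $S_a=\int_{W^N}\Phi_a\,d\mu_N\neq0$ and $S_b=\int_{W^N}\Phi_b\,d\mu_N\ne0$, where $\mu_N$ is Lebesgue measure on $W^N$. Put $S_N=\int_{W^N}\Phi_a\Phi_b\,d\mu_N$. Let $D$ be a Poisson point process on $W$ with constant intensity $\lambda>0$ and, for every $\rho>0$, let $R=R_\rho$ be a Poisson point process on $W$ with constant intensity $\rho$, independent of $D$. For a kernel $\Phi$ and $0\le i\le N$ let $$D^iR^{N-i}=\sum\Phi(x_1,\dots,x_i,y_1,\dots,y_{N-i}),$$ the sum being over all ordered tuples of pairwise distinct points $x_1,\dots,x_i$ of $D$ and pairwise distinct points $y_1,\dots,y_{N-i}$ of $R$. For $c\in\{a,b\}$ consider the edge-corrected estimator $$\hat w_{c,N}=\frac1{S_c}\sum_{i=0}^N\binom Ni(-1)^{N-i}\,\frac{D^iR^{N-i}}{\lambda^i\rho^{N-i}}\qquad(\text{with }\Phi=\Phi_c).$$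 Then, for every $\rho>0$, $\hat w_{a,N}$ and $\hat w_{b,N}$ are square integrable and have mean $0$, so that $\mathrm{Cov}(\hat w_{a,N},\hat w_{b,N})=\langle\hat w_{a,N}\hat w_{b,N}\rangle$, and $$\lim_{\rho\to\infty}\mathrm{Cov}(\hat w_{a,N},\hat w_{b,N})=\frac{S_N\,N!}{S_aS_b\,\lambda^N}.$$ In particular, for $\Phi_a=\Phi_b$ the limiting variance is $S_NN!/(S^2\lambda^N)$ with $S=S_a=S_b$. No term of lower order in $1/\lambda$ is present; correspondingly, for every integer $i\ge0$, $$\sum_{j=0}^N\binom Nj\binom ji(-1)^{N-j}=\delta_{Ni}.$$ -/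

import Mathlib

open MeasureTheory ProbabilityTheory Filter Topology

noncomputable section

/-- The number of points of the finite configuration `X` that lie in `A`. -/
def pointCount {E : Type*} (X : Finset E) (A : Set E) : ℕ :=
  ((X : Set E) ∩ A).ncard

/-- A random finite set `X` of points of `E` is a Poisson point process with intensity measure `μ`
under `P`: the numbers of points in measurable sets are random variables, the number of points in a
measurable set `A` of finite intensity has the Poisson law with mean `μ A`, and the numbers of
points in finitely many pairwise disjoint measurable sets are independent. -/
structure IsPoissonProcess {Ω E : Type*} [MeasurableSpace Ω] [MeasurableSpace E]
    (μ : Measure E) (X : Ω → Finset E) (P : Measure Ω) : Prop where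
  measurable_count : ∀ A : Set E, MeasurableSet A → Measurable fun ω => pointCount (X ω) A
  law_count : ∀ A : Set E, MeasurableSet A → μ A ≠ ⊤ →
    P.map (fun ω => pointCount (X ω) A) = poissonMeasure (μ A).toNNReal
  indep_count : ∀ (n : ℕ) (A : Fin n → Set E), (∀ i, MeasurableSet (A i)) →
    Pairwise (fun i j => Disjoint (A i) (A j)) →
    iIndepFun (fun i ω => pointCount (X ω) (A i)) P

/-- The sigma-algebra on `Ω` generated by a random finite set, that is, by its numbers of points in
the measurable sets. -/
abbrev processSigma {Ω E : Type*} [MeasurableSpace E] (X : Ω → Finset E) : MeasurableSpace Ω :=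
  ⨆ (A : Set E) (_ : MeasurableSet A),
    MeasurableSpace.comap (fun ω => pointCount (X ω) A) ⊤

/-- Lebesgue measure on the `N`-fold product of the window `W ⊆ ℝᵈ`. -/
def windowMeasure {d : ℕ} (W : Set (EuclideanSpace ℝ (Fin d))) (N : ℕ) :
    Measure (Fin N → EuclideanSpace ℝ (Fin d)) :=
  Measure.pi fun _ => volume.restrict W

open Classical in
/-- `D^p R^(N-p) = ∑ Φ(x₁, …, x_p, y₁, …, y_{N-p})`: the sum over all `N`-tuples whose first `p`
entries are pairwise distinct points of `D` and whose remaining entries are pairwise distinct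
points of `R`. -/
def tupleSum {E : Type*} {N : ℕ} (Φ : (Fin N → E) → ℝ) (p : ℕ) (D R : Finset E) : ℝ :=
  ∑ t ∈ Fintype.piFinset (fun k : Fin N => if (k : ℕ) < p then D else R) with
    Set.InjOn t {k : Fin N | (k : ℕ) < p} ∧ Set.InjOn t {k : Fin N | p ≤ (k : ℕ)}, Φ t

/-- `S = ∫ Φ dμ_N` over the window. -/
def kernelIntegral {d N : ℕ} (W : Set (EuclideanSpace ℝ (Fin d)))
    (Φ : (Fin N → EuclideanSpace ℝ (Fin d)) → ℝ) : ℝ :=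
  ∫ x, Φ x ∂windowMeasure W N

/-- The edge-corrected `N`-point estimator
`(1/S) ∑ᵢ C(N,i) (-1)^(N-i) (D/lam)^i (R/rho)^(N-i)` for the kernel `Φ`. -/
def edgeEstimator {d N : ℕ} (W : Set (EuclideanSpace ℝ (Fin d)))
    (Φ : (Fin N → EuclideanSpace ℝ (Fin d)) → ℝ) (lam rho : ℝ)
    (D R : Finset (EuclideanSpace ℝ (Fin d))) : ℝ :=
  1 / kernelIntegral W Φ * ∑ i ∈ Finset.range (N + 1),
    (N.choose i : ℝ) * (-1) ^ (N - i) * (tupleSum Φ i D R / (lam ^ i * rho ^ (N - i)))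

end

/-! Put a mark `lam⁻¹` on every point of D and `-rho⁻¹` on every point of R. For a symmetric kernel
the alternating binomial sum is then a single sum of Φ over the N-tuples of distinct points of the
marked disjoint union, each weighted by the product of its marks (`sum_tupleSum_eq_tupleIntegral`).
It is thus a multiple stochastic integral of order N against the signed random measure ξ = D/lam -
R/rho.

The measure ξ is centred, has independent values on disjoint sets, and has variance κμ with κ =
1/lam + 1/rho (`isOrthogonalNoise_disjSum`). Hence on step functions vanishing on repeated cells the
integral I is centred, and E[I(Φ)I(Ψ)] = κ^N ∑_σ ∫ Φ·(Ψ∘σ), because products of ξ over different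
sets of cells are orthogonal (`integral_mul_stepFun`).

The intensity has no atoms, since a point of a finite set has multiplicity at most one, whereas a
Poisson count at an atom could equal 2. So such step functions are dense in L²(μ^N). An L¹ bound
from the first moment of tuple sums ensures that the L² extension of I is still the pointwise tuple
sum and not merely an abstract limit (`eLpNorm_tupleIntegral_le`). The isometry then passes to all
square integrable kernels (`integral_mul_tupleIntegral`).

For symmetric kernels all N! permutations contribute equally, so the covariance is exactly κ^N N!
S_N/(S_a S_b) for every rho, and κ → 1/lam. The binomial identity is proved separately, by expanding
X^N = ((X+1) - 1)^N. -/

noncomputable section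

/-! ### Dyadic cells and tuples with entries in distinct cells -/

section Cells

variable {F : Type*}

/-- The first `n` binary digits of a point, for a sequence of binary digits `b`. Its fibres are the
cells of level `n`. -/
def cellCode (b : ℕ → F → Bool) (n : ℕ) (x : F) : Fin n → Bool := fun i => b i x

lemma measurable_cellCode [MeasurableSpace F] {b : ℕ → F → Bool} (hb : ∀ n, Measurable (b n))
    (n : ℕ) : Measurable (cellCode b n) :=
  measurable_pi_lambda _ fun i => hb i

lemma cellCode_castLE (b : ℕ → F → Bool) {m n : ℕ} (h : m ≤ n) (x : F) :
    cellCode b m x = fun i => cellCode b n x (Fin.castLE h i) := rfl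

/-- The tuples whose entries lie in pairwise distinct cells of level `n`. -/
def separatedTuples (b : ℕ → F → Bool) (N n : ℕ) : Set (Fin N → F) :=
  {t | Function.Injective fun k => cellCode b n (t k)}

lemma separatedTuples_mono (b : ℕ → F → Bool) (N : ℕ) : Monotone (separatedTuples b N) := by
  intro m n h t ht k l hkl
  refine ht ?_
  simp only [cellCode_castLE b h] at hkl ⊢
  ext i
  exact congrFun hkl _

/-- A tuple has finitely many pairs of entries, so one level separates all of them. Distinctness
thereby becomes a countable increasing union of sets on which independence over disjoint cells
applies. -/
lemma iUnion_separatedTuples {b : ℕ → F → Bool}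
    (hsep : ∀ x y, (∀ n, b n x = b n y) → x = y) (N : ℕ) :
    ⋃ n, separatedTuples b N n = {t | Function.Injective t} := by
  ext t
  simp only [Set.mem_iUnion, Set.mem_ofPred_eq]
  constructor
  · rintro ⟨n, hn⟩ k l hkl
    exact hn (by simp [hkl])
  · intro ht
    have key : ∀ q : Fin N × Fin N, ∃ n, q.1 ≠ q.2 → b n (t q.1) ≠ b n (t q.2) := by
      intro q
      by_cases hq : q.1 = q.2
      · exact ⟨0, fun h => absurd hq h⟩
      · by_contra! hcon
        exact hq (ht (hsep _ _ fun n => (hcon n).2))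
    choose f hf using key
    -- Level n sees only the digits below n, hence the + 1.
    refine ⟨Finset.univ.sup f + 1, fun k l hkl => ?_⟩
    by_contra hne
    have hlt : f (k, l) < Finset.univ.sup f + 1 :=
      Nat.lt_succ_of_le (Finset.le_sup (Finset.mem_univ (k, l)))
    exact hf (k, l) hne (congrFun hkl ⟨f (k, l), hlt⟩)

lemma measurableSet_separatedTuples [MeasurableSpace F] {b : ℕ → F → Bool}
    (hb : ∀ n, Measurable (b n)) (N n : ℕ) : MeasurableSet (separatedTuples b N n) := by
  have h : Measurable fun (t : Fin N → F) k => cellCode b n (t k) :=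
    measurable_pi_lambda _ fun k => (measurable_cellCode hb n).comp (measurable_pi_apply k)
  exact h (Set.toFinite {c | Function.Injective c}).measurableSet

/-- The part of the box `∏ A k` whose entries lie in distinct cells is a disjoint union of boxes. -/
lemma pi_inter_separatedTuples (b : ℕ → F → Bool) (N n : ℕ) (A : Fin N → Set F) :
    Set.univ.pi A ∩ separatedTuples b N n =
      ⋃ c ∈ (Finset.univ.filter Function.Injective : Finset (Fin N → Fin n → Bool)),
        Set.univ.pi fun k => A k ∩ cellCode b n ⁻¹' {c k} := by
  ext t
  simp only [Set.mem_inter_iff, Set.mem_univ_pi, Set.mem_iUnion, Finset.mem_filter,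
    Finset.mem_univ, true_and, Set.mem_preimage, Set.mem_singleton_iff, exists_prop]
  constructor
  · rintro ⟨h1, h2⟩
    exact ⟨fun k => cellCode b n (t k), h2, fun k => ⟨h1 k, rfl⟩⟩
  · rintro ⟨c, hc, h⟩
    refine ⟨fun k => (h k).1, ?_⟩
    have : (fun k => cellCode b n (t k)) = c := funext fun k => (h k).2
    simpa only [separatedTuples, Set.mem_ofPred_eq, this] using hc

lemma measure_pi_inter_separatedTuples [MeasurableSpace F] {b : ℕ → F → Bool}
    (hb : ∀ n, Measurable (b n)) (N n : ℕ) {A : Fin N → Set F} (hA : ∀ k, MeasurableSet (A k))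
    (M : Measure (Fin N → F)) :
    M (Set.univ.pi A ∩ separatedTuples b N n) =
      ∑ c : Fin N → Fin n → Bool with Function.Injective c,
        M (Set.univ.pi fun k => A k ∩ cellCode b n ⁻¹' {c k}) := by
  rw [pi_inter_separatedTuples, measure_biUnion_finset]
  · intro c _ c' _ hne
    refine Set.disjoint_left.2 fun t ht ht' => hne (funext fun k => ?_)
    exact (ht k trivial).2.symm.trans (ht' k trivial).2
  · intro c _
    exact MeasurableSet.univ_pi fun k =>
      (hA k).inter (measurable_cellCode hb n (measurableSet_singleton _))

end Cells

section PointCount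

variable {F : Type*}

open Classical in
lemma pointCount_eq_sum (X : Finset F) (A : Set F) :
    (pointCount X A) = ∑ x ∈ X, if x ∈ A then 1 else 0 := by
  rw [pointCount, Finset.sum_boole, Nat.cast_id, ← Set.ncard_coe_finset]
  congr 1
  ext x
  simp

end PointCount

/-! ### Expected sums over tuples of points -/

section FirstMoment

variable {Ω F : Type*} [MeasurableSpace Ω] [MeasurableSpace F]

/-- A random finite set whose numbers of points in disjoint measurable sets are independent, with
intensity measure `ν`. -/
structure IsScattered (ν : Measure F) (Z : Ω → Finset F) (P : Measure Ω) : Prop where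
  measurable_count : ∀ A : Set F, MeasurableSet A → Measurable fun ω => pointCount (Z ω) A
  indep_count : ∀ (n : ℕ) (A : Fin n → Set F), (∀ i, MeasurableSet (A i)) →
    Pairwise (fun i j => Disjoint (A i) (A j)) →
    iIndepFun (fun i ω => pointCount (Z ω) (A i)) P
  lintegral_count : ∀ A : Set F, MeasurableSet A → ∫⁻ ω, (pointCount (Z ω) A : ENNReal) ∂P = ν A

/-- The counting measure on the `N`-tuples of points of a finite set. -/
def tupleMeasure (N : ℕ) (X : Finset F) : Measure (Fin N → F) :=
  ∑ t ∈ Fintype.piFinset fun _ : Fin N => X, Measure.dirac t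

lemma lintegral_tupleMeasure {N : ℕ} (X : Finset F) {f : (Fin N → F) → ENNReal}
    (hf : Measurable f) :
    ∫⁻ t, f t ∂tupleMeasure N X = ∑ t ∈ Fintype.piFinset fun _ : Fin N => X, f t := by
  simp [tupleMeasure, lintegral_dirac' _ hf]

lemma tupleMeasure_pi {N : ℕ} (X : Finset F) {A : Fin N → Set F}
    (hA : ∀ k, MeasurableSet (A k)) :
    tupleMeasure N X (Set.univ.pi A) = ∏ k, (pointCount X (A k) : ENNReal) := by
  classical
  rw [tupleMeasure, Measure.finsetSum_apply]
  simp only [pointCount_eq_sum, Nat.cast_sum, Finset.prod_univ_sum]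
  refine Finset.sum_congr rfl fun t _ => ?_
  rw [Measure.dirac_apply' _ (MeasurableSet.univ_pi hA)]
  by_cases h : ∀ k, t k ∈ A k
  · simp [h]
  · obtain ⟨k, hk⟩ := not_forall.1 h
    rw [Set.indicator_of_notMem (by simpa using h)]
    exact (Finset.prod_eq_zero (Finset.mem_univ k) (by simp [hk])).symm

instance (N : ℕ) (X : Finset F) : IsFiniteMeasure (tupleMeasure N X) := by
  constructor
  have := tupleMeasure_pi X (A := fun _ : Fin N => (Set.univ : Set F)) fun _ => .univ
  rw [Set.pi_univ] at this
  rw [this]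
  exact ENNReal.prod_lt_top fun k _ => ENNReal.natCast_lt_top _

/-- The tuple measure of a box is a product of counts, and boxes form a generating π-system. The
values of tuple sums are therefore measurable although only the counts are assumed to be. -/
lemma measurable_tupleMeasure {N : ℕ} {Z : Ω → Finset F}
    (hZ : ∀ A : Set F, MeasurableSet A → Measurable fun ω => pointCount (Z ω) A) :
    Measurable fun ω => tupleMeasure N (Z ω) := by
  have h : ∀ A : Fin N → Set F, (∀ k, MeasurableSet (A k)) →
      Measurable fun ω => tupleMeasure N (Z ω) (Set.univ.pi A) := by
    intro A hA
    simp only [tupleMeasure_pi _ hA]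
    exact Finset.measurable_prod _ fun k _ =>
      (measurable_of_countable (Nat.cast : ℕ → ENNReal)).comp (hZ _ (hA k))
  refine Measurable.measure_of_isPiSystem generateFrom_pi.symm isPiSystem_pi ?_ ?_
  · rintro _ ⟨A, hA, rfl⟩
    exact h A fun k => hA k trivial
  · simpa using h (fun _ => Set.univ) fun _ => .univ

lemma measurable_sum_tuples {N : ℕ} {Z : Ω → Finset F}
    (hZ : ∀ A : Set F, MeasurableSet A → Measurable fun ω => pointCount (Z ω) A)
    {f : (Fin N → F) → ENNReal} (hf : Measurable f) :
    Measurable fun ω => ∑ t ∈ Fintype.piFinset fun _ : Fin N => Z ω, f t := by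
  simp only [← lintegral_tupleMeasure _ hf]
  exact (Measure.measurable_lintegral hf).comp (measurable_tupleMeasure hZ)

lemma measurable_sum_tuples_real {N : ℕ} {Z : Ω → Finset F}
    (hZ : ∀ A : Set F, MeasurableSet A → Measurable fun ω => pointCount (Z ω) A)
    {f : (Fin N → F) → ℝ} (hf : Measurable f) :
    Measurable fun ω => ∑ t ∈ Fintype.piFinset fun _ : Fin N => Z ω, f t := by
  have h : ∀ x : ℝ, x = (ENNReal.ofReal x).toReal - (ENNReal.ofReal (-x)).toReal := by
    intro x
    simp only [ENNReal.toReal_ofReal']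
    rcases le_total x 0 with h | h <;> simp [h]
  have h2 : (fun ω => ∑ t ∈ Fintype.piFinset fun _ : Fin N => Z ω, f t) = fun ω =>
      (∑ t ∈ Fintype.piFinset fun _ : Fin N => Z ω, ENNReal.ofReal (f t)).toReal -
        (∑ t ∈ Fintype.piFinset fun _ : Fin N => Z ω, ENNReal.ofReal (-f t)).toReal := by
    ext ω
    rw [ENNReal.toReal_sum fun _ _ => ENNReal.ofReal_ne_top,
      ENNReal.toReal_sum fun _ _ => ENNReal.ofReal_ne_top, ← Finset.sum_sub_distrib]
    exact Finset.sum_congr rfl fun t _ => h _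
  rw [h2]
  exact (measurable_sum_tuples hZ hf.ennreal_ofReal).ennreal_toReal.sub
    (measurable_sum_tuples hZ hf.neg.ennreal_ofReal).ennreal_toReal

/-- The expected number of tuples of points in a box of pairwise disjoint sides. -/
lemma IsScattered.bind_tupleMeasure_pi {ν : Measure F} {Z : Ω → Finset F} {P : Measure Ω}
    (hZ : IsScattered ν Z P) {N : ℕ} {A : Fin N → Set F} (hA : ∀ k, MeasurableSet (A k))
    (hdis : Pairwise fun i j => Disjoint (A i) (A j)) :
    P.bind (fun ω => tupleMeasure N (Z ω)) (Set.univ.pi A) = ∏ k, ν (A k) := by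
  rw [Measure.bind_apply (MeasurableSet.univ_pi hA)
    (measurable_tupleMeasure hZ.measurable_count).aemeasurable]
  simp only [tupleMeasure_pi _ hA]
  have hind := (hZ.indep_count N A hA hdis).comp (fun _ => (Nat.cast : ℕ → ENNReal))
    fun _ => measurable_of_countable _
  have := lintegral_prod_eq_prod_lintegral_of_indepFun Finset.univ _ hind fun k =>
    (measurable_of_countable (Nat.cast : ℕ → ENNReal)).comp (hZ.measurable_count _ (hA k))
  simp only [Function.comp_def] at this
  rw [this]
  exact Finset.prod_congr rfl fun k _ => hZ.lintegral_count _ (hA k)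

/-- Cutting a box along cells leaves boxes with pairwise disjoint sides, for which independence
factorizes the expected number of tuples. Off the diagonal cells the expected tuple measure is thus
the product measure. -/
lemma IsScattered.restrict_bind_tupleMeasure {ν : Measure F} [IsFiniteMeasure ν]
    {Z : Ω → Finset F} {P : Measure Ω} (hZ : IsScattered ν Z P) {b : ℕ → F → Bool}
    (hb : ∀ n, Measurable (b n)) (N n : ℕ) :
    (Measure.pi fun _ : Fin N => ν).restrict (separatedTuples b N n) =
      (P.bind fun ω => tupleMeasure N (Z ω)).restrict (separatedTuples b N n) := by
  have hbox : ∀ A : Fin N → Set F, (∀ k, MeasurableSet (A k)) →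
      (Measure.pi fun _ : Fin N => ν).restrict (separatedTuples b N n) (Set.univ.pi A) =
      (P.bind fun ω => tupleMeasure N (Z ω)).restrict (separatedTuples b N n)
        (Set.univ.pi A) := by
    intro A hA
    rw [Measure.restrict_apply (.univ_pi hA), Measure.restrict_apply (.univ_pi hA),
      measure_pi_inter_separatedTuples hb N n hA, measure_pi_inter_separatedTuples hb N n hA]
    refine Finset.sum_congr rfl fun c hc => ?_
    rw [Measure.pi_pi, hZ.bind_tupleMeasure_pi]
    · exact fun k => (hA k).inter (measurable_cellCode hb n (measurableSet_singleton _))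
    · intro i j hij
      refine Set.disjoint_left.2 fun x hx hx' => hij ((Finset.mem_filter.1 hc).2 ?_)
      exact hx.2.symm.trans hx'.2
  refine ext_of_generate_finite _ generateFrom_pi.symm isPiSystem_pi ?_ ?_
  · rintro _ ⟨A, hA, rfl⟩
    exact hbox A fun k => hA k trivial
  · simpa using hbox (fun _ => Set.univ) fun _ => .univ

open Classical in
/-- First moment bound for sums over tuples of distinct points. -/
lemma IsScattered.lintegral_sum_injective_le {ν : Measure F} [IsFiniteMeasure ν]
    {Z : Ω → Finset F} {P : Measure Ω} (hZ : IsScattered ν Z P) {b : ℕ → F → Bool}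
    (hb : ∀ n, Measurable (b n)) (hsep : ∀ x y, (∀ n, b n x = b n y) → x = y) {N : ℕ}
    {f : (Fin N → F) → ENNReal} (hf : Measurable f) :
    ∫⁻ ω, ∑ t ∈ Fintype.piFinset (fun _ : Fin N => Z ω) with Function.Injective t, f t ∂P ≤
      ∫⁻ t, f t ∂Measure.pi fun _ : Fin N => ν := by
  have hG := measurableSet_separatedTuples hb N
  have hinj : MeasurableSet {t : Fin N → F | Function.Injective t} := by
    rw [← iUnion_separatedTuples hsep]
    exact .iUnion hG
  have h1 : ∀ ω, ∑ t ∈ Fintype.piFinset (fun _ : Fin N => Z ω) with Function.Injective t, f t =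
      ∫⁻ t, ({t | Function.Injective t} : Set (Fin N → F)).indicator f t
        ∂tupleMeasure N (Z ω) := by
    intro ω
    rw [lintegral_tupleMeasure _ (hf.indicator hinj), Finset.sum_filter]
    simp [Set.indicator_apply]
  simp only [h1]
  -- The integral over injective tuples is the supremum of those over separated tuples, where the
  -- expected tuple measure may be replaced by the product measure.
  rw [← Measure.lintegral_bind (measurable_tupleMeasure hZ.measurable_count).aemeasurable
    (hf.indicator hinj).aemeasurable, lintegral_indicator hinj, ← iUnion_separatedTuples hsep,
    setLIntegral_iUnion_of_directed _ (separatedTuples_mono b N).directed_le]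
  refine iSup_le fun n => ?_
  rw [← hZ.restrict_bind_tupleMeasure hb]
  exact setLIntegral_le_lintegral _ _

end FirstMoment

/-! ### Orthogonality of products of independent centred variables -/

section IndependentProducts

variable {Ω ι : Type*} [MeasurableSpace Ω] {P : Measure Ω} {X : ι → Ω → ℝ}

lemma ProbabilityTheory.iIndepFun.integral_prod_mul_prod [Fintype ι] [DecidableEq ι] (hX : iIndepFun X P)
    (hm : ∀ i, Measurable (X i)) (h0 : ∀ i, ∫ ω, X i ω ∂P = 0) (s t : Finset ι) :
    ∫ ω, (∏ i ∈ s, X i ω) * ∏ i ∈ t, X i ω ∂P =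
      if s = t then ∏ i ∈ s, ∫ ω, X i ω ^ 2 ∂P else 0 := by
  have hP := hX.isProbabilityMeasure
  -- Index i contributes its variable to the power [i ∈ s] + [i ∈ t]: a square on s ∩ t, a mean on
  -- the symmetric difference, 1 elsewhere. One factorization over all of ι then covers every case.
  let f : ι → ℝ → ℝ := fun i x => (if i ∈ s then x else 1) * (if i ∈ t then x else 1)
  have hf : ∀ i, Measurable (f i) := fun i => by
    refine Measurable.mul ?_ ?_ <;> split_ifs <;> fun_prop
  have h1 := hX.integral_fun_prod_comp (f := f) (fun i => (hm i).aemeasurable)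
    fun i => (hf i).aestronglyMeasurable
  have h2 : ∀ ω, ∏ i, f i (X i ω) = (∏ i ∈ s, X i ω) * ∏ i ∈ t, X i ω := by
    intro ω
    simp only [f, Finset.prod_mul_distrib, Finset.prod_ite_mem, Finset.univ_inter]
  simp only [h2] at h1
  rw [h1]
  split_ifs with hst
  · subst hst
    rw [← Finset.prod_subset (Finset.subset_univ s)]
    · refine Finset.prod_congr rfl fun i hi => integral_congr_ae (.of_forall fun ω => ?_)
      simp [f, hi, sq]
    · intro i _ hi
      simp [f, hi]
  -- An index in exactly one of the two sets contributes its mean, which is zero.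
  · obtain ⟨i, hi⟩ := not_forall.1 fun h => hst (Finset.ext h)
    refine Finset.prod_eq_zero (Finset.mem_univ i) ?_
    by_cases his : i ∈ s <;> by_cases hit : i ∈ t <;> simp_all [f]

lemma ProbabilityTheory.iIndepFun.memLp_prod (hX : iIndepFun X P)
    (hm : ∀ i, Measurable (X i)) (h2 : ∀ i, MemLp (X i) 2 P) (s : Finset ι) :
    MemLp (fun ω => ∏ i ∈ s, X i ω) 2 P := by
  have hmeas : Measurable fun ω => ∏ i ∈ s, X i ω := Finset.measurable_prod _ fun i _ => hm i
  rw [memLp_two_iff_integrable_sq hmeas.aestronglyMeasurable]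
  refine ⟨(hmeas.pow_const 2).aestronglyMeasurable, ?_⟩
  have hind := hX.comp (fun _ x => ‖x ^ 2‖ₑ) fun _ => by fun_prop
  have := lintegral_prod_eq_prod_lintegral_of_indepFun s _ hind fun i => by
    have := hm i
    simp only [Function.comp_def]
    fun_prop
  rw [HasFiniteIntegral]
  have h : ∀ ω, ‖(∏ i ∈ s, X i ω) ^ 2‖ₑ = ∏ i ∈ s, ‖X i ω ^ 2‖ₑ := by
    intro ω
    rw [← Finset.prod_pow]
    simp [enorm_eq_nnnorm, nnnorm_prod]
  simp only [h]
  simp only [Function.comp_def] at this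
  rw [this]
  exact ENNReal.prod_lt_top fun i _ => (h2 i).integrable_sq.hasFiniteIntegral

end IndependentProducts

/-! ### Multiple integrals of off-diagonal step functions -/

section Noise

variable {Ω E F : Type*} [MeasurableSpace Ω]

open Classical in
/-- The total weight of the points of `X` whose position `p` lies in `A`. -/
def weightedCount (w : F → ℝ) (p : F → E) (X : Finset F) (A : Set E) : ℝ :=
  ∑ z ∈ X, if p z ∈ A then w z else 0

open Classical in
/-- The sum of `Φ` over the positions of the `N`-tuples of distinct points of `X`, each tuple
counted with the product of its weights. -/
def tupleIntegral {N : ℕ} (w : F → ℝ) (p : F → E) (X : Finset F) (Φ : (Fin N → E) → ℝ) : ℝ :=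
  ∑ t ∈ Fintype.piFinset (fun _ : Fin N => X) with Function.Injective t,
    (∏ k, w (t k)) * Φ fun k => p (t k)

/-- The step function of level `n` with values `a`. -/
def stepFun {N n : ℕ} (b : ℕ → E → Bool) (a : (Fin N → Fin n → Bool) → ℝ) (x : Fin N → E) : ℝ :=
  a fun k => cellCode b n (x k)

/-- A kernel on the tuples of cells that vanishes on the tuples with a repeated entry. -/
def OffDiagonal {N n : ℕ} (a : (Fin N → Fin n → Bool) → ℝ) : Prop :=
  ∀ c, ¬ Function.Injective c → a c = 0

/-- Expanding the product of weighted counts gives a sum over all tuples. Those with a repeated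
point have a repeated cell, where the coefficient vanishes, so the distinctness condition costs
nothing. -/
lemma tupleIntegral_stepFun {N n : ℕ} (w : F → ℝ) (p : F → E) (X : Finset F) (b : ℕ → E → Bool)
    {a : (Fin N → Fin n → Bool) → ℝ} (ha : OffDiagonal a) :
    tupleIntegral w p X (stepFun b a) =
      ∑ c, a c * ∏ k, weightedCount w p X (cellCode b n ⁻¹' {c k}) := by
  classical
  simp only [weightedCount, Finset.prod_univ_sum, Finset.mul_sum]
  rw [Finset.sum_comm, tupleIntegral, Finset.sum_filter]
  refine Finset.sum_congr rfl fun t _ => ?_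
  rw [Finset.sum_eq_single fun k => cellCode b n (p (t k))]
  · split_ifs with ht
    · simp [stepFun, mul_comm]
    · rw [ha _ fun h => ht ?_, zero_mul]
      exact fun i j hij => h (by simp [hij])
  · intro c _ hc
    obtain ⟨k, hk⟩ := Function.ne_iff.1 hc
    rw [Finset.prod_eq_zero (Finset.mem_univ k), mul_zero]
    simp [hk.symm]
  · simp

/-- Writing the product over the set of cells used puts it in the form to which the orthogonality of
products over index sets applies. -/
lemma tupleIntegral_stepFun_image {N n : ℕ} (w : F → ℝ) (p : F → E) (X : Finset F)
    (b : ℕ → E → Bool) {a : (Fin N → Fin n → Bool) → ℝ} (ha : OffDiagonal a) :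
    tupleIntegral w p X (stepFun b a) = ∑ c, a c * ∏ i ∈ Finset.univ.image c,
      weightedCount w p X (cellCode b n ⁻¹' {i}) := by
  rw [tupleIntegral_stepFun w p _ b ha]
  refine Finset.sum_congr rfl fun c _ => ?_
  by_cases hc : Function.Injective c
  · rw [Finset.prod_image hc.injOn]
  · simp [ha c hc]

variable [MeasurableSpace E]

/-- The weighted counts of a random finite set form a centred orthogonal random measure with
independent values on disjoint sets and variance `κ • μ`. -/
structure IsOrthogonalNoise (μ : Measure E) (κ : ℝ) (w : F → ℝ) (p : F → E) (Z : Ω → Finset F)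
    (P : Measure Ω) : Prop where
  measurable : ∀ A, MeasurableSet A → Measurable fun ω => weightedCount w p (Z ω) A
  memLp : ∀ A, MeasurableSet A → MemLp (fun ω => weightedCount w p (Z ω) A) 2 P
  mean : ∀ A, MeasurableSet A → ∫ ω, weightedCount w p (Z ω) A ∂P = 0
  var : ∀ A, MeasurableSet A → ∫ ω, weightedCount w p (Z ω) A ^ 2 ∂P = κ * μ.real A
  indep : ∀ (n : ℕ) (A : Fin n → Set E), (∀ i, MeasurableSet (A i)) →
    Pairwise (fun i j => Disjoint (A i) (A j)) →
    iIndepFun (fun i ω => weightedCount w p (Z ω) (A i)) P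

namespace IsOrthogonalNoise

variable {μ : Measure E} {κ : ℝ} {w : F → ℝ} {p : F → E} {Z : Ω → Finset F}
  {P : Measure Ω} {b : ℕ → E → Bool}

lemma indep_cells (h : IsOrthogonalNoise μ κ w p Z P) (hb : ∀ n, Measurable (b n)) (n : ℕ) :
    iIndepFun (fun (c : Fin n → Bool) ω => weightedCount w p (Z ω) (cellCode b n ⁻¹' {c})) P := by
  have e := Fintype.equivFin (Fin n → Bool)
  have h1 := h.indep _ (fun i => cellCode b n ⁻¹' {e.symm i})
    (fun i => measurable_cellCode hb n (measurableSet_singleton _)) fun i j hij =>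
      Set.disjoint_left.2 fun x hx hx' => hij (e.symm.injective (hx.symm.trans hx'))
  simpa using h1.precomp e.injective

lemma memLp_stepFun (h : IsOrthogonalNoise μ κ w p Z P) (hb : ∀ n, Measurable (b n)) {N n : ℕ}
    {a : (Fin N → Fin n → Bool) → ℝ} (ha : OffDiagonal a) :
    MemLp (fun ω => tupleIntegral w p (Z ω) (stepFun b a)) 2 P := by
  simp only [tupleIntegral_stepFun_image w p _ b ha]
  have hmeas := fun i => measurable_cellCode hb n (measurableSet_singleton i)
  exact memLp_finsetSum _ fun c _ => ((h.indep_cells hb n).memLp_prod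
    (fun i => h.measurable _ (hmeas i)) (fun i => h.memLp _ (hmeas i)) _).const_mul _

lemma integral_stepFun (h : IsOrthogonalNoise μ κ w p Z P) (hb : ∀ n, Measurable (b n)) {N n : ℕ}
    (hN : 1 ≤ N) {a : (Fin N → Fin n → Bool) → ℝ} (ha : OffDiagonal a) :
    ∫ ω, tupleIntegral w p (Z ω) (stepFun b a) ∂P = 0 := by
  have hmeas := fun i => measurable_cellCode hb n (measurableSet_singleton i)
  simp only [tupleIntegral_stepFun_image w p _ b ha]
  have hind := h.indep_cells hb n
  have := hind.isProbabilityMeasure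
  rw [integral_finsetSum]
  · refine Finset.sum_eq_zero fun c _ => ?_
    rw [integral_const_mul]
    -- Pairing with the empty product gives the mean; it vanishes because N ≥ 1 makes the set of
    -- cells nonempty.
    have := hind.integral_prod_mul_prod (fun i => h.measurable _ (hmeas i))
      (fun i => h.mean _ (hmeas i)) (Finset.univ.image c) ∅
    rw [if_neg] at this
    · simpa using Or.inr this
    · exact (Finset.image_nonempty.2 ⟨⟨0, hN⟩, Finset.mem_univ _⟩).ne_empty
  · intro c _
    exact ((hind.memLp_prod (fun i => h.measurable _ (hmeas i))
      (fun i => h.memLp _ (hmeas i)) _).const_mul _).integrable one_le_two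

/-- Two injective tuples have the same entries iff they differ by a permutation of the indices. -/
lemma sum_image_eq_sum_perm {N : ℕ} {ι : Type*} [Fintype ι] [DecidableEq ι] {c : Fin N → ι}
    (hc : Function.Injective c) (f : (Fin N → ι) → ℝ)
    (hf : ∀ c', ¬ Function.Injective c' → f c' = 0) :
    ∑ c', (if Finset.univ.image c = Finset.univ.image c' then f c' else 0) =
      ∑ σ : Equiv.Perm (Fin N), f (c ∘ σ) := by
  have hinj : Function.Injective fun σ : Equiv.Perm (Fin N) => c ∘ σ := by
    intro σ τ h
    ext k
    exact congrArg Fin.val (hc (congrFun h k))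
  rw [← Finset.sum_image (s := Finset.univ) (g := fun σ : Equiv.Perm (Fin N) => c ∘ σ)
    (f := f) hinj.injOn]
  symm
  rw [← Finset.sum_subset (Finset.subset_univ
    (Finset.univ.image fun σ : Equiv.Perm (Fin N) => c ∘ σ))]
  · refine Finset.sum_congr rfl fun c' hc' => ?_
    obtain ⟨σ, -, rfl⟩ := Finset.mem_image.1 hc'
    rw [if_pos]
    rw [← Finset.image_image, Finset.image_univ_equiv]
  · intro c' _ hc'
    split_ifs with hcc
    · by_contra hne
      have hc'inj : Function.Injective c' := by
        by_contra hn
        exact hne (hf _ hn)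
      have hex : ∀ k, ∃ l, c l = c' k := by
        intro k
        have : c' k ∈ Finset.univ.image c := hcc ▸ Finset.mem_image_of_mem _ (Finset.mem_univ k)
        simpa using this
      choose τ hτ using hex
      have hτinj : Function.Injective τ := fun i j hij =>
        hc'inj (by rw [← hτ i, ← hτ j, hij])
      refine hc' (Finset.mem_image.2
        ⟨Equiv.ofBijective τ (Finite.injective_iff_bijective.1 hτinj), Finset.mem_univ _, ?_⟩)
      exact funext hτ
    · rfl

lemma integral_comp_cellCode [IsFiniteMeasure μ] (hb : ∀ n, Measurable (b n)) {N n : ℕ}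
    (a : (Fin N → Fin n → Bool) → ℝ) :
    ∫ x, stepFun b a x ∂(Measure.pi fun _ : Fin N => μ) =
      ∑ c, a c * ∏ k, μ.real (cellCode b n ⁻¹' {c k}) := by
  have hm : Measurable fun (x : Fin N → E) k => cellCode b n (x k) :=
    measurable_pi_lambda _ fun k => (measurable_cellCode hb n).comp (measurable_pi_apply k)
  have h1 : ∫ x, stepFun b a x ∂(Measure.pi fun _ : Fin N => μ) =
      ∫ c, a c ∂((Measure.pi fun _ : Fin N => μ).map
        fun (x : Fin N → E) k => cellCode b n (x k)) := by
    rw [integral_map hm.aemeasurable (measurable_of_countable a).aestronglyMeasurable]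
    rfl
  rw [h1, integral_fintype (Integrable.of_finite)]
  refine Finset.sum_congr rfl fun c _ => ?_
  rw [smul_eq_mul, mul_comm, map_measureReal_apply hm (measurableSet_singleton _)]
  congr 1
  have : (fun (x : Fin N → E) k => cellCode b n (x k)) ⁻¹' {c} =
      Set.univ.pi fun k => cellCode b n ⁻¹' {c k} := by
    ext x
    simp [funext_iff]
  rw [this, measureReal_def, Measure.pi_pi, ENNReal.toReal_prod]
  rfl

/-- The isometry property for off-diagonal step functions. -/
lemma integral_mul_stepFun [IsFiniteMeasure μ] (h : IsOrthogonalNoise μ κ w p Z P)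
    (hb : ∀ n, Measurable (b n)) {N n : ℕ} {a a' : (Fin N → Fin n → Bool) → ℝ}
    (ha : OffDiagonal a) (ha' : OffDiagonal a') :
    ∫ ω, tupleIntegral w p (Z ω) (stepFun b a) * tupleIntegral w p (Z ω) (stepFun b a') ∂P =
      κ ^ N * ∑ σ : Equiv.Perm (Fin N), ∫ x, stepFun b a x * stepFun b a' (x ∘ σ)
        ∂(Measure.pi fun _ : Fin N => μ) := by
  classical
  have hmeas := fun i => measurable_cellCode hb n (measurableSet_singleton i)
  have hind := h.indep_cells hb n
  set X : (Fin n → Bool) → Ω → ℝ := fun c ω => weightedCount w p (Z ω) (cellCode b n ⁻¹' {c})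
    with hX
  have hXm : ∀ i, Measurable (X i) := fun i => h.measurable _ (hmeas i)
  have hX2 : ∀ s : Finset (Fin n → Bool), MemLp (fun ω => ∏ i ∈ s, X i ω) 2 P :=
    hind.memLp_prod hXm fun i => h.memLp _ (hmeas i)
  simp only [tupleIntegral_stepFun_image w p _ b ha, tupleIntegral_stepFun_image w p _ b ha',
    Finset.sum_mul_sum]
  have hint : ∀ c c' : Fin N → Fin n → Bool, Integrable (fun ω =>
      (a c * ∏ i ∈ Finset.univ.image c, X i ω) *
        (a' c' * ∏ i ∈ Finset.univ.image c', X i ω)) P := fun c c' =>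
    ((hX2 _).const_mul _).integrable_mul ((hX2 _).const_mul _)
  rw [integral_finsetSum _ fun c _ => integrable_finsetSum _ fun c' _ => hint c c']
  have hstep : ∀ σ : Equiv.Perm (Fin N), (fun x => stepFun b a x * stepFun b a' (x ∘ σ)) =
      stepFun b fun c => a c * a' (c ∘ σ) := fun σ => rfl
  simp only [hstep, integral_comp_cellCode hb, Finset.mul_sum]
  rw [Finset.sum_comm]
  refine Finset.sum_congr rfl fun c _ => ?_
  rw [integral_finsetSum _ fun c' _ => hint c c']
  by_cases hc : Function.Injective c
  · have h1 : ∀ c', ∫ ω, (a c * ∏ i ∈ Finset.univ.image c, X i ω) *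
        (a' c' * ∏ i ∈ Finset.univ.image c', X i ω) ∂P =
        if Finset.univ.image c = Finset.univ.image c' then
          a c * a' c' * (κ ^ N * ∏ k, μ.real (cellCode b n ⁻¹' {c k})) else 0 := by
      intro c'
      simp only [mul_mul_mul_comm (a c) _ (a' c') _]
      rw [integral_const_mul, hind.integral_prod_mul_prod hXm (fun i => h.mean _ (hmeas i))]
      split_ifs with hcc
      · congr 1
        simp only [hX, h.var _ (hmeas _), Finset.prod_mul_distrib, Finset.prod_const,
          Finset.card_image_of_injective _ hc, Finset.card_univ, Fintype.card_fin]
        rw [Finset.prod_image hc.injOn]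
      · simp
    simp only [h1]
    -- Only tuples c' with the same set of cells as c survive; being injective, they are the
    -- rearrangements of c, whence the sum over permutations.
    rw [sum_image_eq_sum_perm hc fun c' =>
      a c * a' c' * (κ ^ N * ∏ k, μ.real (cellCode b n ⁻¹' {c k}))]
    · exact Finset.sum_congr rfl fun σ _ => by ring
    · intro c' hc'
      simp [ha' c' hc']
  · simp [ha c hc]

end IsOrthogonalNoise

end Noise

/-! ### Density of off-diagonal step functions in L² -/

section Density

variable {E : Type*} {b : ℕ → E → Bool}

/-- The sets of tuples determined by the cells of the entries at some level. -/
def cellAlgebra (b : ℕ → E → Bool) (N : ℕ) : Set (Set (Fin N → E)) :=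
  {s | ∃ (n : ℕ) (S : Set (Fin N → Fin n → Bool)), s = {x | (fun k => cellCode b n (x k)) ∈ S}}

lemma exists_lift_cells {N m n : ℕ} (h : m ≤ n) (S : Set (Fin N → Fin m → Bool)) :
    ∃ T : Set (Fin N → Fin n → Bool),
      {x : Fin N → E | (fun k => cellCode b m (x k)) ∈ S} = {x | (fun k => cellCode b n (x k)) ∈ T} :=
  ⟨{c | (fun k i => c k (Fin.castLE h i)) ∈ S}, rfl⟩

lemma OffDiagonal.exists_lift {N m n : ℕ} (h : m ≤ n) {a : (Fin N → Fin m → Bool) → ℝ}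
    (ha : OffDiagonal a) :
    ∃ a' : (Fin N → Fin n → Bool) → ℝ, OffDiagonal a' ∧ stepFun b a = stepFun b a' := by
  refine ⟨fun c => a fun k i => c k (Fin.castLE h i), fun c hc => ha _ fun hinj => hc ?_, rfl⟩
  exact fun k l hkl => hinj (by simp only [hkl])

lemma isSetAlgebra_cellAlgebra (N : ℕ) : IsSetAlgebra (cellAlgebra b N) where
  empty_mem := ⟨0, ∅, by simp⟩
  compl_mem := by
    rintro _ ⟨n, S, rfl⟩
    exact ⟨n, Sᶜ, rfl⟩
  union_mem := by
    rintro _ _ ⟨m, S, rfl⟩ ⟨n, T, rfl⟩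
    obtain ⟨S', hS⟩ := exists_lift_cells (b := b) (le_max_left m n) S
    obtain ⟨T', hT⟩ := exists_lift_cells (b := b) (le_max_right m n) T
    exact ⟨max m n, S' ∪ T', by rw [hS, hT]; rfl⟩

variable [MeasurableSpace E] {μ : Measure E} [IsFiniteMeasure μ]

/-- Almost every tuple has distinct entries when the measure has no atoms. -/
lemma ae_injective_pi [NullSingletonClass μ] (hb : ∀ n, Measurable (b n))
    (hsep : ∀ x y, (∀ n, b n x = b n y) → x = y) (N : ℕ) :
    ∀ᵐ x ∂(Measure.pi fun _ : Fin N => μ), Function.Injective x := by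
  have key : ∀ k l : Fin N, k ≠ l → ∀ᵐ x ∂(Measure.pi fun _ : Fin N => μ), x k ≠ x l := by
    intro k l hkl
    obtain _ | m := N
    · exact k.elim0
    obtain ⟨j, rfl⟩ := Fin.exists_succAbove_eq hkl.symm
    have hmp := measurePreserving_piFinSuccAbove (fun _ : Fin (m + 1) => μ) k
    have hS : MeasurableSet {q : E × (Fin m → E) | q.1 = q.2 j} := by
      have : {q : E × (Fin m → E) | q.1 = q.2 j} = ⋂ n, {q | b n q.1 = b n (q.2 j)} := by
        ext q
        simp only [Set.mem_ofPred_eq, Set.mem_iInter]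
        exact ⟨fun h n => by rw [h], hsep _ _⟩
      rw [this]
      exact .iInter fun n => measurableSet_eq_fun ((hb n).comp measurable_fst)
        ((hb n).comp ((measurable_pi_apply j).comp measurable_snd))
    -- By Fubini the diagonal is null: each of its slices is a singleton.
    have h0 : (μ.prod (Measure.pi fun _ : Fin m => μ)) {q | q.1 = q.2 j} = 0 := by
      rw [Measure.prod_apply_symm hS]
      simp
    rw [ae_iff]
    have := hmp.measure_preimage hS.nullMeasurableSet
    rw [h0] at this
    convert this using 2
    ext x
    simp [MeasurableEquiv.piFinSuccAbove, Fin.insertNthEquiv, Fin.removeNth]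
  have : ∀ᵐ x ∂(Measure.pi fun _ : Fin N => μ), ∀ q : Fin N × Fin N,
      q.1 ≠ q.2 → x q.1 ≠ x q.2 := by
    rw [ae_all_iff]
    intro q
    by_cases hq : q.1 = q.2
    · simp [hq]
    · filter_upwards [key _ _ hq] with x hx _ using hx
  filter_upwards [this] with x hx k l hkl
  by_contra hne
  exact hx (k, l) hne hkl

lemma measurable_cellCodes (hb : ∀ n, Measurable (b n)) (N n : ℕ) :
    Measurable fun (x : Fin N → E) k => cellCode b n (x k) :=
  measurable_pi_lambda _ fun k => (measurable_cellCode hb n).comp (measurable_pi_apply k)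

lemma measurable_stepFun (hb : ∀ n, Measurable (b n)) {N n : ℕ}
    (a : (Fin N → Fin n → Bool) → ℝ) : Measurable (stepFun b a) :=
  (measurable_of_countable a).comp (measurable_cellCodes hb N n)

lemma generateFrom_cellAlgebra (hb : ∀ n, Measurable (b n))
    (hgen : ‹MeasurableSpace E› = MeasurableSpace.generateFrom (Set.range fun n => b n ⁻¹' {true}))
    (N : ℕ) : MeasurableSpace.pi = MeasurableSpace.generateFrom (cellAlgebra b N) := by
  apply le_antisymm
  · refine iSup_le fun k => ?_
    rw [hgen, MeasurableSpace.comap_generateFrom]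
    refine MeasurableSpace.generateFrom_le ?_
    rintro _ ⟨_, ⟨n, rfl⟩, rfl⟩
    -- Digit n is the last digit of the code of level n + 1.
    refine MeasurableSpace.measurableSet_generateFrom
      ⟨n + 1, {c | c k (Fin.last n) = true}, ?_⟩
    ext x
    simp [cellCode]
  · refine MeasurableSpace.generateFrom_le ?_
    rintro _ ⟨n, S, rfl⟩
    exact measurable_cellCodes hb N n (Set.toFinite S).measurableSet

/-- Off-diagonal step functions are dense in `L²` of a product of measures without atoms. -/
lemma exists_offDiagonal_stepFun_eLpNorm_sub_le [NullSingletonClass μ] (hb : ∀ n, Measurable (b n))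
    (hsep : ∀ x y, (∀ n, b n x = b n y) → x = y)
    (hgen : ‹MeasurableSpace E› = MeasurableSpace.generateFrom (Set.range fun n => b n ⁻¹' {true}))
    {N : ℕ} {Φ : (Fin N → E) → ℝ} (hΦ : MemLp Φ 2 (Measure.pi fun _ : Fin N => μ))
    {ε : ENNReal} (hε : ε ≠ 0) :
    ∃ (n : ℕ) (a : (Fin N → Fin n → Bool) → ℝ), OffDiagonal a ∧
      eLpNorm (Φ - stepFun b a) 2 (Measure.pi fun _ : Fin N => μ) ≤ ε := by
  classical
  set M := Measure.pi fun _ : Fin N => μ with hM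
  have hsets : ∀ (s : Set (Fin N → E)), MeasurableSet s → ∀ η : NNReal, 0 < η →
      ∃ (n : ℕ) (S : Set (Fin N → Fin n → Bool)), (∀ c ∈ S, Function.Injective c) ∧
        M (symmDiff {x | (fun k => cellCode b n (x k)) ∈ S} s) ≤ η := by
    intro s hs η hη
    have hdense := Measure.MeasureDense.of_generateFrom_isSetAlgebra_finite M
      (isSetAlgebra_cellAlgebra (b := b) N) (generateFrom_cellAlgebra hb hgen N)
    obtain ⟨_, ⟨m, S, rfl⟩, hS⟩ := hdense.approx s hs (measure_ne_top _ _) (η / 2 : ℝ)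
      (by positivity)
    -- The tuples not separated at level n decrease to the non-injective ones, a null set in the
    -- absence of atoms.
    have hlim : Tendsto (fun n => M (separatedTuples b N n)ᶜ) atTop (𝓝 0) := by
      have h1 := tendsto_measure_iInter_atTop (μ := M)
        (s := fun n => (separatedTuples b N n)ᶜ)
        (fun n => (measurableSet_separatedTuples hb N n).compl.nullMeasurableSet)
        (fun i j hij => Set.compl_subset_compl.2 (separatedTuples_mono b N hij))
        ⟨0, measure_ne_top _ _⟩
      rw [← Set.compl_iUnion, iUnion_separatedTuples hsep] at h1
      rwa [show M {t | Function.Injective t}ᶜ = 0 from ae_injective_pi hb hsep N] at h1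
    have hη2 : (0 : ENNReal) < ENNReal.ofReal (η / 2 : ℝ) := by
      rw [ENNReal.ofReal_pos]; positivity
    obtain ⟨n, hn, hmn⟩ := ((hlim.eventually (gt_mem_nhds hη2)).and
      (eventually_ge_atTop m)).exists
    obtain ⟨T, hT⟩ := exists_lift_cells (b := b) hmn S
    -- Dropping the non-injective codes changes the approximating set only on non-separated tuples,
    -- so the error is at most η/2 + η/2.
    refine ⟨n, T ∩ {c | Function.Injective c}, fun c hc => hc.2, ?_⟩
    calc M (symmDiff {x | (fun k => cellCode b n (x k)) ∈ T ∩ {c | Function.Injective c}} s)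
        ≤ M (symmDiff s {x | (fun k => cellCode b n (x k)) ∈ T} ∪ (separatedTuples b N n)ᶜ) := by
          refine measure_mono fun x hx => ?_
          simp only [Set.mem_symmDiff, Set.mem_ofPred_eq, Set.mem_inter_iff, Set.mem_union,
            Set.mem_compl_iff, separatedTuples] at hx ⊢
          tauto
      _ ≤ ENNReal.ofReal (η / 2 : ℝ) + ENNReal.ofReal (η / 2 : ℝ) := by
          refine (measure_union_le _ _).trans (add_le_add ?_ hn.le)
          rw [← hT]
          exact hS.le
      _ = η := by
          rw [← ENNReal.ofReal_add (by positivity) (by positivity), add_halves,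
            ENNReal.ofReal_coe_nnreal]
  suffices h : ∃ g, eLpNorm (Φ - g) 2 M ≤ ε ∧
      ∃ (n : ℕ) (a : (Fin N → Fin n → Bool) → ℝ), OffDiagonal a ∧ g = stepFun b a by
    obtain ⟨g, hg, n, a, ha, rfl⟩ := h
    exact ⟨n, a, ha, hg⟩
  refine MemLp.induction_dense (p := 2) (μ := M) (by simp)
    (fun g => ∃ (n : ℕ) (a : (Fin N → Fin n → Bool) → ℝ), OffDiagonal a ∧ g = stepFun b a)
    ?_ ?_ ?_ hΦ hε
  · intro c s hs _ ε hε
    obtain ⟨η, hη, hηε⟩ := exists_eLpNorm_indicator_le (μ := M) (p := 2) (by simp) c hε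
    obtain ⟨n, S, hS, hSη⟩ := hsets s hs η hη
    refine ⟨_, ?_, n, S.indicator fun _ => c, ?_, rfl⟩
    · have : stepFun b (S.indicator fun _ => c) =
          ({x | (fun k => cellCode b n (x k)) ∈ S} : Set (Fin N → E)).indicator fun _ => c := rfl
      rw [this, eLpNorm_indicator_sub_indicator]
      exact hηε _ hSη
    · intro c' hc'
      exact Set.indicator_of_notMem (fun h => hc' (hS _ h)) _
  · rintro _ _ ⟨m, a, ha, rfl⟩ ⟨n, a', ha', rfl⟩
    obtain ⟨a₁, ha₁, h₁⟩ := ha.exists_lift (b := b) (le_max_left m n)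
    obtain ⟨a₂, ha₂, h₂⟩ := ha'.exists_lift (b := b) (le_max_right m n)
    refine ⟨max m n, a₁ + a₂, fun c hc => by simp [ha₁ c hc, ha₂ c hc], ?_⟩
    rw [h₁, h₂]
    rfl
  · rintro _ ⟨n, a, ha, rfl⟩
    exact (measurable_stepFun hb a).aestronglyMeasurable

end Density

/-! ### Norms and inner products in L² -/

section HilbertSpace

variable {α : Type*} [MeasurableSpace α] {μ : Measure α}

lemma MeasureTheory.MemLp.eLpNorm_two_eq_ofReal_sqrt {f : α → ℝ} (hf : MemLp f 2 μ) :
    eLpNorm f 2 μ = ENNReal.ofReal √(∫ x, f x * f x ∂μ) := by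
  rw [hf.eLpNorm_eq_integral_rpow_norm (by simp) (by simp), Real.sqrt_eq_rpow]
  simp [sq]

/-- The integral of a product is continuous along `L²`-convergent sequences. -/
lemma tendsto_integral_mul {f g : ℕ → α → ℝ} {f' g' : α → ℝ} (hf : ∀ n, MemLp (f n) 2 μ)
    (hg : ∀ n, MemLp (g n) 2 μ) (hf' : MemLp f' 2 μ) (hg' : MemLp g' 2 μ)
    (hff' : Tendsto (fun n => eLpNorm (f n - f') 2 μ) atTop (𝓝 0))
    (hgg' : Tendsto (fun n => eLpNorm (g n - g') 2 μ) atTop (𝓝 0)) :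
    Tendsto (fun n => ∫ x, f n x * g n x ∂μ) atTop (𝓝 (∫ x, f' x * g' x ∂μ)) := by
  have hinner : ∀ {u v : α → ℝ} (hu : MemLp u 2 μ) (hv : MemLp v 2 μ),
      inner ℝ (hu.toLp u) (hv.toLp v) = ∫ x, u x * v x ∂μ := by
    intro u v hu hv
    rw [L2.inner_def]
    refine integral_congr_ae ?_
    filter_upwards [hu.coeFn_toLp, hv.coeFn_toLp] with x hx hy
    simp [hx, hy, mul_comm]
  simp only [← hinner (hf _) (hg _), ← hinner hf' hg']
  exact ((Lp.tendsto_Lp_iff_tendsto_eLpNorm'' f hf f' hf').2 hff').inner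
    ((Lp.tendsto_Lp_iff_tendsto_eLpNorm'' g hg g' hg').2 hgg')

end HilbertSpace

/-! ### Permuting the coordinates of a product measure -/

section Permutation

variable {E : Type*} [MeasurableSpace E]

lemma measurePreserving_comp_perm (μ : Measure E) [SigmaFinite μ] {N : ℕ}
    (σ : Equiv.Perm (Fin N)) :
    MeasurePreserving (fun x : Fin N → E => x ∘ σ) (Measure.pi fun _ => μ)
      (Measure.pi fun _ => μ) :=
  measurePreserving_arrowCongr' (fun _ => μ) (fun _ => μ) σ.symm (MeasurableEquiv.refl E)
    fun _ => MeasurePreserving.id μ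

/-- Integrate 2uv ≤ u² + v² and use the permutation invariance of the product measure. -/
lemma integral_mul_comp_perm_le (μ : Measure E) [SigmaFinite μ] {N : ℕ} {Φ : (Fin N → E) → ℝ}
    (hΦ : MemLp Φ 2 (Measure.pi fun _ => μ)) (σ : Equiv.Perm (Fin N)) :
    ∫ x, Φ x * Φ (x ∘ σ) ∂(Measure.pi fun _ => μ) ≤
      ∫ x, Φ x * Φ x ∂(Measure.pi fun _ => μ) := by
  have hσ := measurePreserving_comp_perm μ σ
  have hΦσ : MemLp (fun x => Φ (x ∘ σ)) 2 (Measure.pi fun _ : Fin N => μ) :=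
    hΦ.comp_measurePreserving hσ
  have hint : Integrable (fun x => Φ x * Φ x) (Measure.pi fun _ : Fin N => μ) :=
    hΦ.integrable_mul hΦ
  have hintσ : Integrable (fun x => Φ (x ∘ σ) * Φ (x ∘ σ)) (Measure.pi fun _ : Fin N => μ) :=
    hΦσ.integrable_mul hΦσ
  have h1 : ∫ x, Φ (x ∘ σ) * Φ (x ∘ σ) ∂(Measure.pi fun _ : Fin N => μ) =
      ∫ x, Φ x * Φ x ∂(Measure.pi fun _ => μ) := by
    have hm : AEStronglyMeasurable (fun x => Φ x * Φ x) ((Measure.pi fun _ : Fin N => μ).map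
        fun x : Fin N → E => x ∘ σ) := by
      rw [hσ.map_eq]
      exact hint.aestronglyMeasurable
    rw [← integral_map hσ.aemeasurable hm, hσ.map_eq]
  have h2 : ∫ x, Φ x * Φ (x ∘ σ) ∂(Measure.pi fun _ : Fin N => μ) ≤
      ∫ x, (2⁻¹ * (Φ x * Φ x) + 2⁻¹ * (Φ (x ∘ σ) * Φ (x ∘ σ)))
        ∂(Measure.pi fun _ : Fin N => μ) := by
    refine integral_mono (hΦ.integrable_mul hΦσ) ((hint.const_mul _).add
      (hintσ.const_mul _)) fun x => ?_
    simp only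
    nlinarith [sq_nonneg (Φ x - Φ (x ∘ σ))]
  rw [integral_add (hint.const_mul _) (hintσ.const_mul _),
    integral_const_mul, integral_const_mul, h1] at h2
  linarith

end Permutation

/-! ### Extension of the isometry to square integrable kernels -/

section Extension

variable {Ω E F : Type*} [MeasurableSpace Ω]

lemma tupleIntegral_sub {N : ℕ} (w : F → ℝ) (p : F → E) (X : Finset F) (Φ Ψ : (Fin N → E) → ℝ) :
    tupleIntegral w p X (Φ - Ψ) = tupleIntegral w p X Φ - tupleIntegral w p X Ψ := by
  simp [tupleIntegral, mul_sub, Finset.sum_sub_distrib]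

variable [MeasurableSpace E] {μ : Measure E} [IsFiniteMeasure μ]
  {κ : ℝ} {w : F → ℝ} {p : F → E} {Z : Ω → Finset F} {P : Measure Ω} {b : ℕ → E → Bool}

namespace IsOrthogonalNoise

/-- By the isometry the second moment is κ^N times a sum of N! terms, each at most the squared norm
of the step function; this gives the constant. -/
lemma eLpNorm_stepFun_le (h : IsOrthogonalNoise μ κ w p Z P) (hκ : 0 ≤ κ)
    (hb : ∀ n, Measurable (b n)) {N n : ℕ} {a : (Fin N → Fin n → Bool) → ℝ}
    (ha : OffDiagonal a) :
    eLpNorm (fun ω => tupleIntegral w p (Z ω) (stepFun b a)) 2 P ≤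
      ENNReal.ofReal √(κ ^ N * N.factorial) *
        eLpNorm (stepFun b a) 2 (Measure.pi fun _ : Fin N => μ) := by
  have hmem : MemLp (stepFun b a) 2 (Measure.pi fun _ : Fin N => μ) := by
    refine MemLp.of_bound (measurable_stepFun hb a).aestronglyMeasurable
      (∑ c, ‖a c‖) (.of_forall fun x => ?_)
    exact Finset.single_le_sum (f := fun c => ‖a c‖) (fun c _ => norm_nonneg _) (Finset.mem_univ _)
  rw [(h.memLp_stepFun hb ha).eLpNorm_two_eq_ofReal_sqrt, hmem.eLpNorm_two_eq_ofReal_sqrt,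
    ← ENNReal.ofReal_mul (Real.sqrt_nonneg _), ← Real.sqrt_mul (by positivity),
    h.integral_mul_stepFun hb ha ha, mul_assoc]
  refine ENNReal.ofReal_le_ofReal (Real.sqrt_le_sqrt (mul_le_mul_of_nonneg_left ?_ (by positivity)))
  refine (Finset.sum_le_sum fun σ _ => integral_mul_comp_perm_le μ hmem σ).trans_eq ?_
  simp [Fintype.card_perm]

variable [NullSingletonClass μ]

/-- The `L²` bound for general kernels, by approximation with off-diagonal step functions. -/
lemma eLpNorm_tupleIntegral_le [IsFiniteMeasure P] (h : IsOrthogonalNoise μ κ w p Z P)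
    (hκ : 0 ≤ κ)
    (hb : ∀ n, Measurable (b n)) (hsep : ∀ x y, (∀ n, b n x = b n y) → x = y)
    (hgen : ‹MeasurableSpace E› = MeasurableSpace.generateFrom (Set.range fun n => b n ⁻¹' {true}))
    {N : ℕ} (hmeas : ∀ Φ : (Fin N → E) → ℝ, Measurable Φ →
      Measurable fun ω => tupleIntegral w p (Z ω) Φ)
    {C : NNReal} (hC : ∀ Φ : (Fin N → E) → ℝ, Measurable Φ →
      ∫⁻ ω, ‖tupleIntegral w p (Z ω) Φ‖ₑ ∂P ≤ C * ∫⁻ x, ‖Φ x‖ₑ ∂(Measure.pi fun _ => μ))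
    {Φ : (Fin N → E) → ℝ} (hΦ : Measurable Φ) (hΦ2 : MemLp Φ 2 (Measure.pi fun _ => μ)) :
    eLpNorm (fun ω => tupleIntegral w p (Z ω) Φ) 2 P ≤
      ENNReal.ofReal √(κ ^ N * N.factorial) * eLpNorm Φ 2 (Measure.pi fun _ : Fin N => μ) := by
  set M := Measure.pi fun _ : Fin N => μ with hM
  have hε : ∀ j : ℕ, ((j : ENNReal) + 1)⁻¹ ≠ 0 := fun j => by
    simp
  choose n a ha hle using fun j : ℕ =>
    exists_offDiagonal_stepFun_eLpNorm_sub_le hb hsep hgen hΦ2 (hε j)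
  have hε0 : Tendsto (fun j : ℕ => ((j : ENNReal) + 1)⁻¹) atTop (𝓝 0) := by
    have := (tendsto_add_atTop_iff_nat 1).2 ENNReal.tendsto_inv_nat_nhds_zero
    simpa using this
  have hgm : ∀ j, Measurable (stepFun b (a j)) := fun j => measurable_stepFun hb (a j)
  -- On a finite measure space L² approximation implies L¹ approximation, which `hC` transfers to
  -- the tuple sums.
  have hL1 : Tendsto (fun j => eLpNorm ((fun ω => tupleIntegral w p (Z ω) (stepFun b (a j))) -
      fun ω => tupleIntegral w p (Z ω) Φ) 1 P) atTop (𝓝 0) := by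
    have hbound : ∀ j, eLpNorm ((fun ω => tupleIntegral w p (Z ω) (stepFun b (a j))) -
        fun ω => tupleIntegral w p (Z ω) Φ) 1 P ≤
        C * (((j : ENNReal) + 1)⁻¹ * M Set.univ ^ ((1 : ℝ) / 1 - 1 / 2)) := by
      intro j
      rw [eLpNorm_sub_comm, eLpNorm_one_eq_lintegral_enorm]
      simp only [Pi.sub_apply, ← tupleIntegral_sub]
      refine (hC _ (hΦ.sub (hgm j))).trans (mul_le_mul_right ?_ _)
      rw [← eLpNorm_one_eq_lintegral_enorm]
      refine (eLpNorm_le_eLpNorm_mul_rpow_measure_univ (q := 2) (by simp)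
        (hΦ.sub (hgm j)).aestronglyMeasurable).trans ?_
      simp only [ENNReal.toReal_one, ENNReal.toReal_ofNat]
      exact mul_le_mul_left (hle j) _
    refine tendsto_of_tendsto_of_tendsto_of_le_of_le tendsto_const_nhds ?_ (fun _ => zero_le)
      hbound
    have hfin : M Set.univ ^ ((1 : ℝ) / 1 - 1 / 2) ≠ ⊤ :=
      ENNReal.rpow_ne_top_of_nonneg (by norm_num) (measure_ne_top _ _)
    simpa using ENNReal.Tendsto.const_mul
      (ENNReal.Tendsto.mul_const hε0 (Or.inr hfin)) (Or.inr (ENNReal.coe_ne_top (r := C)))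
  -- L¹ convergence yields an almost surely convergent subsequence, to which Fatou applies together
  -- with the L² bounds on step functions.
  obtain ⟨ns, hns, hae⟩ := (tendstoInMeasure_of_tendsto_eLpNorm one_ne_zero
    (fun j => (hmeas _ (hgm j)).aestronglyMeasurable) (hmeas Φ hΦ).aestronglyMeasurable
    hL1).exists_seq_tendsto_ae
  refine (Lp.eLpNorm_lim_le_liminf_eLpNorm
    (fun i => (hmeas _ (hgm (ns i))).aestronglyMeasurable) _ hae).trans ?_
  have hstep : ∀ j, eLpNorm (fun ω => tupleIntegral w p (Z ω) (stepFun b (a j))) 2 P ≤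
      ENNReal.ofReal √(κ ^ N * N.factorial) * (eLpNorm Φ 2 M + ((j : ENNReal) + 1)⁻¹) := by
    intro j
    refine (h.eLpNorm_stepFun_le hκ hb (ha j)).trans (mul_le_mul_right ?_ _)
    have : stepFun b (a j) = Φ - (Φ - stepFun b (a j)) := by simp
    rw [this]
    refine (eLpNorm_sub_le hΦ.aestronglyMeasurable (hΦ.sub (hgm j)).aestronglyMeasurable
      (by norm_num)).trans (add_le_add le_rfl (hle j))
  have hlim : Tendsto (fun i => ENNReal.ofReal √(κ ^ N * N.factorial) *
      (eLpNorm Φ 2 M + ((ns i : ENNReal) + 1)⁻¹)) atTop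
      (𝓝 (ENNReal.ofReal √(κ ^ N * N.factorial) * eLpNorm Φ 2 M)) := by
    have := (hε0.comp hns.tendsto_atTop).const_add (eLpNorm Φ 2 M)
    rw [add_zero] at this
    exact ENNReal.Tendsto.const_mul this (Or.inr ENNReal.ofReal_ne_top)
  rw [← hlim.liminf_eq]
  exact liminf_le_liminf (.of_forall fun i => hstep (ns i))

/-- Centring and isometry of the tuple integral on square integrable kernels. -/
theorem integral_mul_tupleIntegral [IsProbabilityMeasure P] (h : IsOrthogonalNoise μ κ w p Z P)
    (hκ : 0 ≤ κ)
    (hb : ∀ n, Measurable (b n)) (hsep : ∀ x y, (∀ n, b n x = b n y) → x = y)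
    (hgen : ‹MeasurableSpace E› = MeasurableSpace.generateFrom (Set.range fun n => b n ⁻¹' {true}))
    {N : ℕ} (hN : 1 ≤ N) (hmeas : ∀ Φ : (Fin N → E) → ℝ, Measurable Φ →
      Measurable fun ω => tupleIntegral w p (Z ω) Φ)
    {C : NNReal} (hC : ∀ Φ : (Fin N → E) → ℝ, Measurable Φ →
      ∫⁻ ω, ‖tupleIntegral w p (Z ω) Φ‖ₑ ∂P ≤ C * ∫⁻ x, ‖Φ x‖ₑ ∂(Measure.pi fun _ => μ))
    {Φ Ψ : (Fin N → E) → ℝ} (hΦ : Measurable Φ) (hΦ2 : MemLp Φ 2 (Measure.pi fun _ => μ))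
    (hΨ : Measurable Ψ) (hΨ2 : MemLp Ψ 2 (Measure.pi fun _ => μ)) :
    MemLp (fun ω => tupleIntegral w p (Z ω) Φ) 2 P ∧
    ∫ ω, tupleIntegral w p (Z ω) Φ ∂P = 0 ∧
    ∫ ω, tupleIntegral w p (Z ω) Φ * tupleIntegral w p (Z ω) Ψ ∂P =
      κ ^ N * ∑ σ : Equiv.Perm (Fin N), ∫ x, Φ x * Ψ (x ∘ σ)
        ∂(Measure.pi fun _ : Fin N => μ) := by
  set M := Measure.pi fun _ : Fin N => μ with hM
  have hmem : ∀ {Φ : (Fin N → E) → ℝ}, Measurable Φ → MemLp Φ 2 M →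
      MemLp (fun ω => tupleIntegral w p (Z ω) Φ) 2 P := fun {Φ} hΦ hΦ2 =>
    ⟨(hmeas Φ hΦ).aestronglyMeasurable,
      (h.eLpNorm_tupleIntegral_le hκ hb hsep hgen hmeas hC hΦ hΦ2).trans_lt
        (ENNReal.mul_lt_top ENNReal.ofReal_lt_top hΦ2.2)⟩
  have hε : ∀ j : ℕ, ((j : ENNReal) + 1)⁻¹ ≠ 0 := fun j => by
    simp
  have hε0 : Tendsto (fun j : ℕ => ((j : ENNReal) + 1)⁻¹) atTop (𝓝 0) := by
    have := (tendsto_add_atTop_iff_nat 1).2 ENNReal.tendsto_inv_nat_nhds_zero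
    simpa using this
  have happ : ∀ j : ℕ, ∃ (n : ℕ) (a a' : (Fin N → Fin n → Bool) → ℝ), OffDiagonal a ∧
      OffDiagonal a' ∧ eLpNorm (Φ - stepFun b a) 2 M ≤ ((j : ENNReal) + 1)⁻¹ ∧
      eLpNorm (Ψ - stepFun b a') 2 M ≤ ((j : ENNReal) + 1)⁻¹ := by
    intro j
    obtain ⟨m, a, ha, hle⟩ := exists_offDiagonal_stepFun_eLpNorm_sub_le hb hsep hgen hΦ2 (hε j)
    obtain ⟨n, a', ha', hle'⟩ := exists_offDiagonal_stepFun_eLpNorm_sub_le hb hsep hgen hΨ2 (hε j)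
    obtain ⟨a₁, ha₁, h₁⟩ := ha.exists_lift (b := b) (le_max_left m n)
    obtain ⟨a₂, ha₂, h₂⟩ := ha'.exists_lift (b := b) (le_max_right m n)
    -- Both approximants must be step functions of one level for the isometry to apply.
    exact ⟨max m n, a₁, a₂, ha₁, ha₂, h₁ ▸ hle, h₂ ▸ hle'⟩
  choose n a a' ha ha' hle hle' using happ
  have hconv : ∀ {Φ : (Fin N → E) → ℝ}, Measurable Φ → MemLp Φ 2 M →
      ∀ (a : ∀ j, (Fin N → Fin (n j) → Bool) → ℝ),
      (∀ j, eLpNorm (Φ - stepFun b (a j)) 2 M ≤ ((j : ENNReal) + 1)⁻¹) →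
      (∀ j, MemLp (stepFun b (a j)) 2 M) ∧
      Tendsto (fun j => eLpNorm (stepFun b (a j) - Φ) 2 M) atTop (𝓝 0) ∧
      Tendsto (fun j => eLpNorm ((fun ω => tupleIntegral w p (Z ω) (stepFun b (a j))) -
        fun ω => tupleIntegral w p (Z ω) Φ) 2 P) atTop (𝓝 0) := by
    intro Φ hΦ hΦ2 a hle
    have hgm : ∀ j, Measurable (stepFun b (a j)) := fun j => measurable_stepFun hb (a j)
    have hsub : ∀ j, MemLp (Φ - stepFun b (a j)) 2 M := fun j =>
      ⟨(hΦ.sub (hgm j)).aestronglyMeasurable, (hle j).trans_lt (by simp)⟩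
    refine ⟨fun j => ?_, ?_, ?_⟩
    · simpa using hΦ2.sub (hsub j)
    · refine tendsto_of_tendsto_of_tendsto_of_le_of_le tendsto_const_nhds hε0
        (fun _ => zero_le) fun j => ?_
      simp only
      rw [eLpNorm_sub_comm]
      exact hle j
    · have hlim : Tendsto (fun j : ℕ => ENNReal.ofReal √(κ ^ N * N.factorial) *
          ((j : ENNReal) + 1)⁻¹) atTop (𝓝 0) := by
        simpa using ENNReal.Tendsto.const_mul hε0
          (Or.inr (ENNReal.ofReal_ne_top (r := √(κ ^ N * N.factorial))))
      refine tendsto_of_tendsto_of_tendsto_of_le_of_le tendsto_const_nhds hlim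
        (fun _ => zero_le) fun j => ?_
      simp only
      rw [eLpNorm_sub_comm]
      have := h.eLpNorm_tupleIntegral_le hκ hb hsep hgen hmeas hC (hΦ.sub (hgm j)) (hsub j)
      simp only [tupleIntegral_sub] at this
      exact this.trans (mul_le_mul_right (hle j) _)
  obtain ⟨hg2, hgΦ, hIΦ⟩ := hconv hΦ hΦ2 a hle
  obtain ⟨hg2', hgΨ, hIΨ⟩ := hconv hΨ hΨ2 a' hle'
  refine ⟨hmem hΦ hΦ2, ?_, ?_⟩
  -- The mean is the inner product with the constant 1, so it passes to the L² limit.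
  · have h1 := tendsto_integral_mul (μ := P) (f' := fun ω => tupleIntegral w p (Z ω) Φ)
      (fun j => h.memLp_stepFun hb (ha j)) (fun _ => memLp_const (1 : ℝ)) (hmem hΦ hΦ2)
      (memLp_const (1 : ℝ)) hIΦ (by simp)
    simp only [mul_one, h.integral_stepFun hb hN (ha _)] at h1
    exact (tendsto_nhds_unique h1 tendsto_const_nhds)
  · have h1 := tendsto_integral_mul (fun j => h.memLp_stepFun hb (ha j))
      (fun j => h.memLp_stepFun hb (ha' j)) (hmem hΦ hΦ2) (hmem hΨ hΨ2) hIΦ hIΨ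
    simp only [h.integral_mul_stepFun hb (ha _) (ha' _)] at h1
    refine tendsto_nhds_unique h1 (Tendsto.const_mul _ (tendsto_finsetSum _ fun σ _ => ?_))
    have hσ := measurePreserving_comp_perm μ σ
    refine tendsto_integral_mul hg2 (fun j => (hg2' j).comp_measurePreserving hσ) hΦ2
      (hΨ2.comp_measurePreserving hσ) hgΦ ?_
    refine hgΨ.congr fun j => ?_
    exact (eLpNorm_comp_measurePreserving ((hg2' j).sub hΨ2).aestronglyMeasurable hσ).symm

end IsOrthogonalNoise

end Extension

/-! ### From the binomial sum to one sum over marked tuples -/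

section Combinatorics

/-- Binomial inversion in the form `∑ⱼ C(N,j) C(j,i) (-1)^(N-j) = δ`. -/
lemma sum_choose_mul_choose_mul_neg_one_pow (N i : ℕ) :
    ∑ j ∈ Finset.range (N + 1), (N.choose j : ℤ) * (j.choose i : ℤ) * (-1) ^ (N - j) =
      if i = N then 1 else 0 := by
  -- Expand X = (X + 1) + (-1) to the power N; the claim compares the coefficients of X^i.
  have h : (Polynomial.X : Polynomial ℤ) ^ N =
      ∑ j ∈ Finset.range (N + 1),
        (Polynomial.X + 1) ^ j * (-1) ^ (N - j) * (N.choose j : Polynomial ℤ) := by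
    rw [← add_pow]
    simp
  have h2 := congrArg (fun q => Polynomial.coeff q i) h
  simp only [Polynomial.coeff_X_pow, Polynomial.finsetSum_coeff] at h2
  rw [h2]
  refine Finset.sum_congr rfl fun j _ => ?_
  have : (Polynomial.X + 1) ^ j * (-1) ^ (N - j) * (N.choose j : Polynomial ℤ) =
      (Polynomial.X + 1) ^ j * Polynomial.C ((-1) ^ (N - j) * (N.choose j : ℤ)) := by
    simp [mul_assoc]
  rw [this, Polynomial.coeff_mul_C, Polynomial.coeff_X_add_one_pow]
  ring

variable {E : Type*} {N : ℕ}

open Classical in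
/-- The sum of `Φ` over the tuples with pairwise distinct points of `D` at the positions in `s` and
pairwise distinct points of `R` at the other positions. -/
def patternSum (Φ : (Fin N → E) → ℝ) (s : Finset (Fin N)) (D R : Finset E) : ℝ :=
  ∑ t ∈ Fintype.piFinset (fun k : Fin N => if k ∈ s then D else R) with
    Set.InjOn t {k | k ∈ s} ∧ Set.InjOn t {k | k ∉ s}, Φ t

/-- Tuples are grouped by the set s of positions filled from D. A point common to D and R occurs
twice in the disjoint union, so injectivity there means distinctness only within each of the two
groups of positions. -/
lemma tupleIntegral_disjSum (α β : ℝ) (Φ : (Fin N → E) → ℝ) (D R : Finset E) :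
    tupleIntegral (Sum.elim (fun _ => α) fun _ => β) (Sum.elim id id) (D.disjSum R) Φ =
      ∑ s : Finset (Fin N), α ^ s.card * β ^ (N - s.card) * patternSum Φ s D R := by
  classical
  rw [tupleIntegral, ← Finset.sum_fiberwise _
    fun t : Fin N → E ⊕ E => Finset.univ.filter fun k => (t k).isLeft = true]
  refine Finset.sum_congr rfl fun s _ => ?_
  rw [patternSum, Finset.mul_sum]
  refine Finset.sum_bij' (fun t _ k => Sum.elim id id (t k))
    (fun x _ k => if k ∈ s then Sum.inl (x k) else Sum.inr (x k)) ?_ ?_ ?_ ?_ ?_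
  · intro t ht
    simp only [Finset.mem_filter, Fintype.mem_piFinset] at ht ⊢
    obtain ⟨⟨h1, h2⟩, rfl⟩ := ht
    refine ⟨fun k => ?_, ?_, ?_⟩
    · have := h1 k
      rcases hk : t k with x | x <;> simp_all
    · intro k hk l hl hkl
      refine h2 ?_
      rcases hk' : t k with x | x <;> rcases hl' : t l with y | y <;> simp_all
    · intro k hk l hl hkl
      refine h2 ?_
      rcases hk' : t k with x | x <;> rcases hl' : t l with y | y <;> simp_all
  · intro x hx
    simp only [Finset.mem_filter, Fintype.mem_piFinset] at hx ⊢
    obtain ⟨h1, h2, h3⟩ := hx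
    refine ⟨⟨fun k => ?_, fun k l hkl => ?_⟩, ?_⟩
    · have := h1 k
      by_cases hk : k ∈ s <;> simp_all
    · by_cases hk : k ∈ s <;> by_cases hl : l ∈ s <;> simp [hk, hl] at hkl
      · exact h2 hk hl hkl
      · exact h3 hk hl hkl
    · ext k
      by_cases hk : k ∈ s <;> simp [hk]
  · intro t ht
    obtain ⟨-, rfl⟩ := Finset.mem_filter.1 ht
    ext k
    rcases hk : t k with x | x <;> simp [hk]
  · intro x _
    ext k
    by_cases hk : k ∈ s <;> simp [hk]
  · intro t ht
    obtain ⟨-, rfl⟩ := Finset.mem_filter.1 ht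
    congr 1
    have : ∀ k, Sum.elim (fun _ : E => α) (fun _ : E => β) (t k) =
        if (t k).isLeft = true then α else β := by
      intro k
      rcases t k with x | x <;> simp
    simp only [this, Finset.prod_ite, Finset.prod_const]
    congr 2
    have := Finset.card_filter_add_card_filter_not (s := (Finset.univ : Finset (Fin N)))
      fun k => (t k).isLeft = true
    simp only [Finset.card_univ, Fintype.card_fin] at this
    omega

/-- For a symmetric kernel the sum depends only on the number of positions filled from `D`. -/
lemma patternSum_eq_tupleSum {Φ : (Fin N → E) → ℝ}
    (hΦ : ∀ (σ : Equiv.Perm (Fin N)) (x : Fin N → E), Φ (x ∘ σ) = Φ x)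
    (s : Finset (Fin N)) (D R : Finset E) :
    patternSum Φ s D R = tupleSum Φ s.card D R := by
  classical
  have hle : s.card ≤ N := by simpa using s.card_le_univ
  have hcard : Fintype.card {k : Fin N // (k : ℕ) < s.card} = Fintype.card {k // k ∈ s} := by
    rw [Fintype.card_coe, Fintype.card_subtype, Fin.card_filter_val_lt, min_eq_right hle]
  -- A permutation carrying the first `s.card` positions onto s; reindexing by it moves the points
  -- of D to the front.
  let σ : Equiv.Perm (Fin N) := (Fintype.equivOfCardEq hcard).extendSubtype
  have hσ : ∀ k, σ k ∈ s ↔ (k : ℕ) < s.card := fun k =>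
    ⟨fun h => by
      by_contra hk
      exact Equiv.extendSubtype_not_mem _ k hk h,
      fun h => Equiv.extendSubtype_mem _ k h⟩
  have hσ' : ∀ k, ((σ.symm k : Fin N) : ℕ) < s.card ↔ k ∈ s := fun k => by
    rw [← hσ, Equiv.apply_symm_apply]
  rw [patternSum, tupleSum]
  refine Finset.sum_bij' (fun x _ => x ∘ σ) (fun x _ => x ∘ σ.symm) ?_ ?_ ?_ ?_ ?_
  · intro x hx
    simp only [Finset.mem_filter, Fintype.mem_piFinset] at hx ⊢
    obtain ⟨h1, h2, h3⟩ := hx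
    refine ⟨fun k => ?_, fun k hk l hl hkl => ?_, fun k hk l hl hkl => ?_⟩
    · simpa only [hσ, Function.comp_apply] using h1 (σ k)
    · exact σ.injective (h2 ((hσ k).2 hk) ((hσ l).2 hl) hkl)
    · exact σ.injective (h3 (fun h => not_lt.2 hk ((hσ k).1 h))
        (fun h => not_lt.2 hl ((hσ l).1 h)) hkl)
  · intro x hx
    simp only [Finset.mem_filter, Fintype.mem_piFinset] at hx ⊢
    obtain ⟨h1, h2, h3⟩ := hx
    refine ⟨fun k => ?_, fun k hk l hl hkl => ?_, fun k hk l hl hkl => ?_⟩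
    · simpa only [hσ', Function.comp_apply] using h1 (σ.symm k)
    · exact σ.symm.injective (h2 ((hσ' k).2 hk) ((hσ' l).2 hl) hkl)
    · exact σ.symm.injective (h3 (not_lt.1 fun h => hk ((hσ' k).1 h))
        (not_lt.1 fun h => hl ((hσ' l).1 h)) hkl)
  · intro x _
    ext k
    simp
  · intro x _
    ext k
    simp
  · intro x _
    exact (hΦ σ x).symm

/-- The edge-corrected sum of a symmetric kernel is a tuple integral over the union of the two
point sets, marked by `1 / lam` and `-1 / rho`. -/
lemma sum_tupleSum_eq_tupleIntegral {Φ : (Fin N → E) → ℝ}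
    (hΦ : ∀ (σ : Equiv.Perm (Fin N)) (x : Fin N → E), Φ (x ∘ σ) = Φ x)
    (lam rho : ℝ) (D R : Finset E) :
    ∑ i ∈ Finset.range (N + 1),
      (N.choose i : ℝ) * (-1) ^ (N - i) * (tupleSum Φ i D R / (lam ^ i * rho ^ (N - i))) =
    tupleIntegral (Sum.elim (fun _ => lam⁻¹) fun _ => -rho⁻¹) (Sum.elim id id)
      (D.disjSum R) Φ := by
  rw [tupleIntegral_disjSum]
  simp only [patternSum_eq_tupleSum hΦ]
  -- Each size i occurs for C(N,i) sets of positions, which is the binomial coefficient of the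
  -- estimator.
  rw [← Finset.powerset_univ, Finset.sum_powerset_apply_card fun i =>
    lam⁻¹ ^ i * (-rho⁻¹) ^ (N - i) * tupleSum Φ i D R]
  simp only [Finset.card_univ, Fintype.card_fin]
  refine Finset.sum_congr rfl fun i _ => ?_
  rw [nsmul_eq_mul, neg_eq_neg_one_mul rho⁻¹, mul_pow, inv_pow, inv_pow, div_eq_mul_inv, mul_inv]
  ring

end Combinatorics

/-! ### First two moments of the Poisson law -/

section PoissonMoments

lemma hasSum_poisson_mul_natCast (r : NNReal) :
    HasSum (fun n : ℕ => Real.exp (-r) * (r : ℝ) ^ n / n.factorial * n) r := by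
  -- The term n = 0 vanishes and (n+1)/(n+1)! = 1/n!, so the shifted series is r times the total
  -- mass.
  rw [← hasSum_nat_add_iff' 1]
  have h := (hasSum_one_poissonMeasure r).mul_right (r : ℝ)
  simp only [Finset.range_one, Finset.sum_singleton, Nat.cast_zero, mul_zero, sub_zero]
  rw [one_mul] at h
  refine h.congr_fun fun n => ?_
  rw [Nat.factorial_succ]
  push_cast
  field_simp
  ring

lemma hasSum_poisson_mul_natCast_sq (r : NNReal) :
    HasSum (fun n : ℕ => Real.exp (-r) * (r : ℝ) ^ n / n.factorial * (n : ℝ) ^ 2)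
      ((r : ℝ) ^ 2 + r) := by
  -- The same shift leaves one factor n + 1, so the sum is r times (mean + mass).
  rw [← hasSum_nat_add_iff' 1]
  have h := ((hasSum_poisson_mul_natCast r).mul_right (r : ℝ)).add
    ((hasSum_one_poissonMeasure r).mul_right (r : ℝ))
  simp only [Finset.range_one, Finset.sum_singleton, Nat.cast_zero]
  convert! h using 1
  · ext n
    rw [Nat.factorial_succ]
    push_cast
    field_simp
    ring
  · ring

lemma memLp_natCast_poissonMeasure (r : NNReal) :
    MemLp (fun n : ℕ => (n : ℝ)) 2 (poissonMeasure r) := by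
  rw [memLp_two_iff_integrable_sq (measurable_of_countable _).aestronglyMeasurable,
    integrable_poissonMeasure_iff]
  simpa using (hasSum_poisson_mul_natCast_sq r).summable

lemma integral_natCast_poissonMeasure (r : NNReal) :
    ∫ n : ℕ, (n : ℝ) ∂poissonMeasure r = r := by
  rw [integral_poissonMeasure]
  exact (hasSum_poisson_mul_natCast r).tsum_eq

lemma variance_natCast_poissonMeasure (r : NNReal) :
    variance (fun n : ℕ => (n : ℝ)) (poissonMeasure r) = r := by
  rw [variance_eq_sub (memLp_natCast_poissonMeasure r), integral_natCast_poissonMeasure]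
  have : ∫ n : ℕ, (n : ℝ) ^ 2 ∂poissonMeasure r = (r : ℝ) ^ 2 + r := by
    rw [integral_poissonMeasure]
    exact (hasSum_poisson_mul_natCast_sq r).tsum_eq
  simp [this]

end PoissonMoments

/-! ### Moments of counts and absence of atoms -/

section PoissonProcess

variable {Ω E : Type*} [MeasurableSpace Ω] [MeasurableSpace E] {P : Measure Ω} {ν : Measure E}
  {X : Ω → Finset E} {A : Set E}

namespace IsPoissonProcess

lemma measurable_count_real (hX : IsPoissonProcess ν X P) (hA : MeasurableSet A) :
    Measurable fun ω => (pointCount (X ω) A : ℝ) :=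
  (measurable_of_countable (Nat.cast : ℕ → ℝ)).comp (hX.measurable_count A hA)

variable [IsFiniteMeasure ν]

lemma memLp_count (hX : IsPoissonProcess ν X P) (hA : MeasurableSet A) :
    MemLp (fun ω => (pointCount (X ω) A : ℝ)) 2 P := by
  have := memLp_natCast_poissonMeasure (ν A).toNNReal
  rw [← hX.law_count A hA (measure_ne_top _ _)] at this
  exact this.comp_of_map (hX.measurable_count A hA).aemeasurable

lemma integral_count (hX : IsPoissonProcess ν X P) (hA : MeasurableSet A) :
    ∫ ω, (pointCount (X ω) A : ℝ) ∂P = ν.real A := by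
  have := integral_natCast_poissonMeasure (ν A).toNNReal
  rw [← hX.law_count A hA (measure_ne_top _ _),
    integral_map (hX.measurable_count A hA).aemeasurable
      (measurable_of_countable _).aestronglyMeasurable] at this
  exact this

lemma variance_count (hX : IsPoissonProcess ν X P) (hA : MeasurableSet A) :
    variance (fun ω => (pointCount (X ω) A : ℝ)) P = ν.real A := by
  have := variance_natCast_poissonMeasure (ν A).toNNReal
  rw [← hX.law_count A hA (measure_ne_top _ _),
    variance_map (measurable_of_countable _).aemeasurable
      (hX.measurable_count A hA).aemeasurable] at this
  exact this

lemma lintegral_count [IsFiniteMeasure P] (hX : IsPoissonProcess ν X P) (hA : MeasurableSet A) :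
    ∫⁻ ω, (pointCount (X ω) A : ENNReal) ∂P = ν A := by
  have h := ofReal_integral_eq_lintegral_ofReal ((hX.memLp_count hA).integrable one_le_two)
    (.of_forall fun ω => Nat.cast_nonneg _)
  rw [hX.integral_count hA, measureReal_def, ENNReal.ofReal_toReal (measure_ne_top _ _)] at h
  simpa using h.symm

/-- The intensity measure of a Poisson process without multiple points has no atoms. -/
lemma nullSingletonClass [MeasurableSingletonClass E] (hX : IsPoissonProcess ν X P) :
    NullSingletonClass ν where
  measure_singleton x := by
    by_contra hx
    have hr : 0 < (ν {x}).toNNReal := ENNReal.toNNReal_pos hx (measure_ne_top _ _)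
    -- The value 2 has positive Poisson probability, yet a finite set contains x at most once.
    have h1 := poissonMeasure_real_singleton_pos 2 hr
    rw [← hX.law_count {x} (measurableSet_singleton x) (measure_ne_top _ _),
      map_measureReal_apply (hX.measurable_count _ (measurableSet_singleton x))
        (measurableSet_singleton _)] at h1
    have h2 : (fun ω => pointCount (X ω) {x}) ⁻¹' {2} = ∅ := by
      ext ω
      have : pointCount (X ω) {x} ≤ 1 :=
        (Set.ncard_le_ncard Set.inter_subset_right).trans_eq (Set.ncard_singleton x)
      simp only [Set.mem_preimage, Set.mem_singleton_iff, Set.mem_empty_iff_false, iff_false]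
      omega
    simp [h2] at h1

end IsPoissonProcess

end PoissonProcess

/-! ### The marked union of two independent Poisson processes -/

section Superposition

/-- Componentwise pairs of two independent families of independent variables are independent. -/
lemma iIndepFun_prodMk {Ω ι : Type*} {m₁ m₂ : MeasurableSpace Ω} [MeasurableSpace Ω]
    {P : Measure Ω} {X Y : ι → Ω → ℕ} (hX : iIndepFun X P) (hY : iIndepFun Y P)
    (hm : Indep m₁ m₂ P) (hX₁ : ∀ i, Measurable[m₁] (X i)) (hY₂ : ∀ i, Measurable[m₂] (Y i))
    (hXm : ∀ i, Measurable (X i)) (hYm : ∀ i, Measurable (Y i)) :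
    iIndepFun (fun i ω => (X i ω, Y i ω)) P := by
  refine iIndepSets.iIndep (fun i => ((hXm i).prodMk (hYm i)).comap_le)
    (fun i => Set.preimage (fun ω => (X i ω, Y i ω)) ''
      Set.image2 (· ×ˢ ·) {s | MeasurableSet s} {t | MeasurableSet t}) ?_ ?_ ?_
  · intro i
    have := (isPiSystem_prod (α := ℕ) (β := ℕ)).comap fun ω => (X i ω, Y i ω)
    exact this
  · intro i
    rw [← MeasurableSpace.comap_generateFrom, generateFrom_prod]
  · rw [iIndepSets_iff]
    intro s f hf
    have hf' : ∀ i, ∃ S T : Set ℕ, i ∈ s → f i = X i ⁻¹' S ∩ Y i ⁻¹' T := by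
      intro i
      by_cases hi : i ∈ s
      · obtain ⟨_, ⟨S, _, T, _, rfl⟩, h⟩ := hf i hi
        exact ⟨S, T, fun _ => h.symm⟩
      · exact ⟨∅, ∅, fun h => absurd h hi⟩
    choose S T hST using hf'
    have hXS : ∀ i, MeasurableSet[m₁] (X i ⁻¹' S i) := fun i =>
      hX₁ i (Set.to_countable _).measurableSet
    have hYT : ∀ i, MeasurableSet[m₂] (Y i ⁻¹' T i) := fun i =>
      hY₂ i (Set.to_countable _).measurableSet
    have h1 : ⋂ i ∈ s, f i = (⋂ i ∈ s, X i ⁻¹' S i) ∩ ⋂ i ∈ s, Y i ⁻¹' T i := by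
      rw [Set.iInter₂_congr hST]
      ext ω
      simp only [Set.mem_iInter, Set.mem_inter_iff]
      exact ⟨fun h => ⟨fun i hi => (h i hi).1, fun i hi => (h i hi).2⟩,
        fun h i hi => ⟨h.1 i hi, h.2 i hi⟩⟩
    rw [h1, (Indep_iff m₁ m₂ P).1 hm _ _
      (s.measurableSet_biInter fun i _ => hXS i) (s.measurableSet_biInter fun i _ => hYT i),
      iIndepFun_iff_measure_inter_preimage_eq_mul.1 hX s fun i _ =>
        (Set.to_countable _).measurableSet,
      iIndepFun_iff_measure_inter_preimage_eq_mul.1 hY s fun i _ =>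
        (Set.to_countable _).measurableSet, ← Finset.prod_mul_distrib]
    refine Finset.prod_congr rfl fun i hi => ?_
    rw [hST i hi, (Indep_iff m₁ m₂ P).1 hm _ _ (hXS i) (hYT i)]

variable {Ω E : Type*}

lemma pointCount_disjSum (D R : Finset E) (A : Set (E ⊕ E)) :
    pointCount (D.disjSum R) A =
      pointCount D (Sum.inl ⁻¹' A) + pointCount R (Sum.inr ⁻¹' A) := by
  classical
  simp only [pointCount_eq_sum, Finset.sum_disjSum]
  rfl

lemma weightedCount_disjSum (α β : ℝ) (D R : Finset E) (A : Set E) :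
    weightedCount (Sum.elim (fun _ => α) fun _ => β) (Sum.elim id id) (D.disjSum R) A =
      α * pointCount D A + β * pointCount R A := by
  classical
  simp only [weightedCount, pointCount_eq_sum, Finset.sum_disjSum, Nat.cast_sum, Finset.mul_sum]
  congr 1 <;>
  · refine Finset.sum_congr rfl fun x _ => ?_
    by_cases hx : x ∈ A <;> simp [hx]

variable [MeasurableSpace E]

lemma measurable_processSigma_count (X : Ω → Finset E) {A : Set E} (hA : MeasurableSet A) :
    Measurable[processSigma X] fun ω => pointCount (X ω) A := by
  rw [measurable_iff_comap_le]
  exact le_iSup₂_of_le (f := fun (A : Set E) (_ : MeasurableSet A) =>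
    MeasurableSpace.comap (fun ω => pointCount (X ω) A) ⊤) A hA le_rfl

variable [MeasurableSpace Ω] {P : Measure Ω} {ν₁ ν₂ : Measure E} {D R : Ω → Finset E}

lemma IsPoissonProcess.iIndepFun_counts (hD : IsPoissonProcess ν₁ D P)
    (hR : IsPoissonProcess ν₂ R P) (hDR : Indep (processSigma D) (processSigma R) P) {n : ℕ}
    {A B : Fin n → Set E} (hA : ∀ i, MeasurableSet (A i)) (hB : ∀ i, MeasurableSet (B i))
    (hA' : Pairwise fun i j => Disjoint (A i) (A j))
    (hB' : Pairwise fun i j => Disjoint (B i) (B j)) :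
    iIndepFun (fun i ω => (pointCount (D ω) (A i), pointCount (R ω) (B i))) P :=
  iIndepFun_prodMk (hD.indep_count n A hA hA') (hR.indep_count n B hB hB') hDR
    (fun i => measurable_processSigma_count D (hA i))
    (fun i => measurable_processSigma_count R (hB i))
    (fun i => hD.measurable_count _ (hA i)) fun i => hR.measurable_count _ (hB i)

/-- The marked union of two independent Poisson processes. -/
lemma IsPoissonProcess.isScattered_disjSum [IsProbabilityMeasure P] [IsFiniteMeasure ν₁]
    [IsFiniteMeasure ν₂] (hD : IsPoissonProcess ν₁ D P)
    (hR : IsPoissonProcess ν₂ R P) (hDR : Indep (processSigma D) (processSigma R) P) :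
    IsScattered (ν₁.map Sum.inl + ν₂.map Sum.inr) (fun ω => (D ω).disjSum (R ω)) P where
  measurable_count A hA := by
    simp only [pointCount_disjSum]
    exact (hD.measurable_count _ (measurable_inl hA)).add
      (hR.measurable_count _ (measurable_inr hA))
  indep_count n A hA hdis := by
    simp only [pointCount_disjSum]
    exact (hD.iIndepFun_counts hR hDR (fun i => measurable_inl (hA i))
      (fun i => measurable_inr (hA i)) (fun i j h => (hdis h).preimage _)
      fun i j h => (hdis h).preimage _).comp (fun _ q => q.1 + q.2) fun _ =>
        measurable_of_countable _
  lintegral_count A hA := by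
    simp only [pointCount_disjSum, Nat.cast_add]
    have hm : Measurable fun ω => (pointCount (D ω) (Sum.inl ⁻¹' A) : ENNReal) :=
      (measurable_of_countable (Nat.cast : ℕ → ENNReal)).comp
        (hD.measurable_count _ (measurable_inl hA))
    rw [lintegral_add_left hm, hD.lintegral_count (measurable_inl hA),
      hR.lintegral_count (measurable_inr hA), Measure.add_apply,
      Measure.map_apply measurable_inl hA, Measure.map_apply measurable_inr hA]

/-- The difference of two independent Poisson processes of constant relative intensity, normalized
to have mean zero. -/
lemma IsPoissonProcess.isOrthogonalNoise_disjSum [IsProbabilityMeasure P] {μ : Measure E} [IsFiniteMeasure μ]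
    {lam rho : ℝ} (hlam : 0 < lam) (hrho : 0 < rho)
    (hD : IsPoissonProcess (ENNReal.ofReal lam • μ) D P)
    (hR : IsPoissonProcess (ENNReal.ofReal rho • μ) R P)
    (hDR : Indep (processSigma D) (processSigma R) P) :
    IsOrthogonalNoise μ (lam⁻¹ + rho⁻¹) (Sum.elim (fun _ => lam⁻¹) fun _ => -rho⁻¹)
      (Sum.elim id id) (fun ω => (D ω).disjSum (R ω)) P := by
  have hfin : ∀ r : ℝ, IsFiniteMeasure (ENNReal.ofReal r • μ) := fun r =>
    Measure.smul_finite μ ENNReal.ofReal_ne_top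
  have hreal : ∀ {r : ℝ}, 0 < r → ∀ A, (ENNReal.ofReal r • μ).real A = r * μ.real A := by
    intro r hr A
    rw [measureReal_ennreal_smul_apply, ENNReal.toReal_ofReal hr.le]
  have hDm := fun {A : Set E} (hA : MeasurableSet A) => (hD.memLp_count hA).const_mul lam⁻¹
  have hRm := fun {A : Set E} (hA : MeasurableSet A) => (hR.memLp_count hA).const_mul (-rho⁻¹)
  have hmean : ∀ A, MeasurableSet A →
      ∫ ω, (lam⁻¹ * pointCount (D ω) A + -rho⁻¹ * pointCount (R ω) A) ∂P = 0 := by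
    intro A hA
    rw [integral_add ((hDm hA).integrable one_le_two) ((hRm hA).integrable one_le_two),
      integral_const_mul, integral_const_mul, hD.integral_count hA, hR.integral_count hA,
      hreal hlam, hreal hrho]
    field_simp
    ring
  constructor <;> simp only [weightedCount_disjSum]
  · intro A hA
    exact ((hD.measurable_count_real hA).const_mul _).add
      ((hR.measurable_count_real hA).const_mul _)
  · exact fun A hA => (hDm hA).add (hRm hA)
  · exact hmean
  · intro A hA
    have hind : IndepFun (fun ω => lam⁻¹ * (pointCount (D ω) A : ℝ))
        (fun ω => -rho⁻¹ * (pointCount (R ω) A : ℝ)) P := by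
      have h0 : IndepFun (fun ω => pointCount (D ω) A) (fun ω => pointCount (R ω) A) P :=
        (indep_of_indep_of_le_left (indep_of_indep_of_le_right hDR
          (measurable_processSigma_count R hA).comap_le)
          (measurable_processSigma_count D hA).comap_le)
      exact h0.comp (φ := fun n : ℕ => lam⁻¹ * (n : ℝ)) (ψ := fun n : ℕ => -rho⁻¹ * (n : ℝ))
        (measurable_of_countable _) (measurable_of_countable _)
    -- As the mean is zero, the second moment is the variance: (lam⁻²·lam + rho⁻²·rho) μ(A).
    have hv := hind.variance_add (hDm hA) (hRm hA)
    rw [variance_eq_sub ((hDm hA).add (hRm hA))] at hv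
    simp only [Pi.add_apply, Pi.pow_apply, hmean A hA] at hv
    rw [variance_const_mul, variance_const_mul, hD.variance_count hA, hR.variance_count hA,
      hreal hlam, hreal hrho] at hv
    rw [zero_pow two_ne_zero, sub_zero] at hv
    rw [hv]
    field_simp
  · intro n A hA hdis
    exact (hD.iIndepFun_counts hR hDR hA hA hdis hdis).comp
      (fun _ q => lam⁻¹ * (q.1 : ℝ) + -rho⁻¹ * (q.2 : ℝ)) fun _ => measurable_of_countable _

end Superposition

/-! ### Measurability and L¹ bounds for tuple sums -/

section TupleBounds

variable {Ω E F : Type*} [MeasurableSpace Ω] [MeasurableSpace E] [MeasurableSpace F]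
  {P : Measure Ω} {Z : Ω → Finset F} {w : F → ℝ} {p : F → E} {b : ℕ → F → Bool}

lemma measurable_tupleIntegral
    (hZ : ∀ A : Set F, MeasurableSet A → Measurable fun ω => pointCount (Z ω) A)
    (hw : Measurable w) (hp : Measurable p) (hb : ∀ n, Measurable (b n))
    (hsep : ∀ x y, (∀ n, b n x = b n y) → x = y) {N : ℕ} {Φ : (Fin N → E) → ℝ}
    (hΦ : Measurable Φ) : Measurable fun ω => tupleIntegral w p (Z ω) Φ := by
  classical
  have hinj : MeasurableSet {t : Fin N → F | Function.Injective t} := by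
    rw [← iUnion_separatedTuples hsep]
    exact .iUnion (measurableSet_separatedTuples hb N)
  have hf : Measurable fun t : Fin N → F => (∏ k, w (t k)) * Φ fun k => p (t k) :=
    (Finset.measurable_prod _ fun k _ => hw.comp (measurable_pi_apply k)).mul
      (hΦ.comp (measurable_pi_lambda _ fun k => hp.comp (measurable_pi_apply k)))
  convert! measurable_sum_tuples_real hZ (hf.indicator hinj) using 2 with ω
  rw [tupleIntegral, Finset.sum_filter]
  simp [Set.indicator_apply]

/-- The `L¹` bound for tuple integrals. -/
lemma IsScattered.lintegral_tupleIntegral_le {ν : Measure F} [IsFiniteMeasure ν]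
    (hZ : IsScattered ν Z P) (hp : Measurable p) (hb : ∀ n, Measurable (b n))
    (hsep : ∀ x y, (∀ n, b n x = b n y) → x = y) {H K : NNReal} (hH : ∀ z, ‖w z‖ₑ ≤ H)
    {μ : Measure E} [IsFiniteMeasure μ] (hν : ν.map p = K • μ) {N : ℕ}
    {Φ : (Fin N → E) → ℝ} (hΦ : Measurable Φ) :
    ∫⁻ ω, ‖tupleIntegral w p (Z ω) Φ‖ₑ ∂P ≤
      (H ^ N * K ^ N : NNReal) * ∫⁻ x, ‖Φ x‖ₑ ∂(Measure.pi fun _ => μ) := by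
  classical
  have hpt : Measurable fun (t : Fin N → F) k => p (t k) :=
    measurable_pi_lambda _ fun k => hp.comp (measurable_pi_apply k)
  have hle : ∀ ω, ‖tupleIntegral w p (Z ω) Φ‖ₑ ≤
      ∑ t ∈ Fintype.piFinset (fun _ : Fin N => Z ω) with Function.Injective t,
        (H : ENNReal) ^ N * ‖Φ fun k => p (t k)‖ₑ := by
    intro ω
    refine (enorm_sum_le _ _).trans (Finset.sum_le_sum fun t _ => ?_)
    rw [enorm_mul]
    refine mul_le_mul_left ?_ _
    calc ‖∏ k, w (t k)‖ₑ = ∏ k, ‖w (t k)‖ₑ := by simp [enorm_eq_nnnorm, nnnorm_prod]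
      _ ≤ ∏ _k : Fin N, (H : ENNReal) := Finset.prod_le_prod' fun k _ => hH _
      _ = (H : ENNReal) ^ N := by simp
  -- Forgetting the marks maps ν to K • μ, hence the N-fold product of ν to K^N times that of μ.
  have hpi : (Measure.pi fun _ : Fin N => ν).map (fun t k => p (t k)) =
      (K ^ N : NNReal) • Measure.pi fun _ : Fin N => μ := by
    rw [Measure.pi_map_pi fun _ => hp.aemeasurable]
    refine (Measure.pi_eq fun A hA => ?_)
    simp only [hν, Measure.smul_apply, ENNReal.smul_def, smul_eq_mul, Measure.pi_pi,
      Finset.prod_mul_distrib, Finset.prod_const, Finset.card_univ, Fintype.card_fin,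
      ENNReal.coe_pow]
  refine (lintegral_mono hle).trans ?_
  refine (hZ.lintegral_sum_injective_le hb hsep (f := fun t =>
    (H : ENNReal) ^ N * ‖Φ fun k => p (t k)‖ₑ) ((hΦ.comp hpt).enorm.const_mul _)).trans_eq ?_
  rw [lintegral_const_mul _ (f := fun t : Fin N → F => ‖Φ fun k => p (t k)‖ₑ)
    (hΦ.comp hpt).enorm, ← lintegral_map (f := fun x => ‖Φ x‖ₑ)
    hΦ.enorm hpt, hpi, lintegral_smul_measure]
  simp [ENNReal.smul_def, mul_assoc]

end TupleBounds

/-! ### The isometry for two Poisson processes -/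

section EdgeCorrection

variable {Ω E : Type*}

/-- Binary digits separating the points of the disjoint union of two copies of `E`. -/
def sumDigits (b : ℕ → E → Bool) : ℕ → E ⊕ E → Bool
  | 0 => Sum.elim (fun _ => true) fun _ => false
  | n + 1 => Sum.elim (b n) (b n)

lemma eq_of_sumDigits_eq {b : ℕ → E → Bool} (hsep : ∀ x y, (∀ n, b n x = b n y) → x = y)
    (x y : E ⊕ E) (h : ∀ n, sumDigits b n x = sumDigits b n y) : x = y := by
  have h0 := h 0
  rcases x with x | x <;> rcases y with y | y <;> simp [sumDigits] at h0
  · exact congrArg _ (hsep x y fun n => h (n + 1))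
  · exact congrArg _ (hsep x y fun n => h (n + 1))

variable [MeasurableSpace Ω] [MeasurableSpace E]

lemma measurable_sumDigits {b : ℕ → E → Bool} (hb : ∀ n, Measurable (b n)) :
    ∀ n, Measurable (sumDigits b n)
  | 0 => measurable_const.sumElim measurable_const
  | n + 1 => (hb n).sumElim (hb n)

/-- Centring and isometry for the edge-corrected sums over two independent Poisson processes. -/
theorem IsPoissonProcess.tupleIntegral_disjSum [MeasurableSpace.CountablyGenerated E]
    [MeasurableSingletonClass E] {P : Measure Ω} [IsProbabilityMeasure P]
    {μ : Measure E} [IsFiniteMeasure μ] {lam rho : ℝ} (hlam : 0 < lam) (hrho : 0 < rho)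
    {D R : Ω → Finset E} (hD : IsPoissonProcess (ENNReal.ofReal lam • μ) D P)
    (hR : IsPoissonProcess (ENNReal.ofReal rho • μ) R P)
    (hDR : Indep (processSigma D) (processSigma R) P) {N : ℕ} (hN : 1 ≤ N)
    {Φ Ψ : (Fin N → E) → ℝ} (hΦ : Measurable Φ) (hΦ2 : MemLp Φ 2 (Measure.pi fun _ => μ))
    (hΨ : Measurable Ψ) (hΨ2 : MemLp Ψ 2 (Measure.pi fun _ => μ)) :
    let I := fun (Φ : (Fin N → E) → ℝ) ω => tupleIntegral (Sum.elim (fun _ => lam⁻¹)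
      fun _ => -rho⁻¹) (Sum.elim id id) ((D ω).disjSum (R ω)) Φ
    MemLp (I Φ) 2 P ∧ ∫ ω, I Φ ω ∂P = 0 ∧
    ∫ ω, I Φ ω * I Ψ ω ∂P = (lam⁻¹ + rho⁻¹) ^ N * ∑ σ : Equiv.Perm (Fin N),
      ∫ x, Φ x * Ψ (x ∘ σ) ∂(Measure.pi fun _ : Fin N => μ) := by
  intro I
  have hfin : ∀ r : ℝ, IsFiniteMeasure (ENNReal.ofReal r • μ) := fun r =>
    Measure.smul_finite μ ENNReal.ofReal_ne_top
  have hatom : NullSingletonClass μ := by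
    refine ⟨fun x => ?_⟩
    have := hD.nullSingletonClass.measure_singleton x
    simpa [hlam.not_ge] using this
  -- The digits are the indicators of a countable generating sequence; they separate points because
  -- singletons are measurable.
  let b : ℕ → E → Bool := fun n x => MeasurableSpace.mapNatBool E x n
  have hb : ∀ n, Measurable (b n) := fun n =>
    (measurable_pi_apply n).comp (MeasurableSpace.measurable_mapNatBool E)
  have hsep : ∀ x y, (∀ n, b n x = b n y) → x = y := fun x y h =>
    MeasurableSpace.injective_mapNatBool E (funext h)
  have hgen : ‹MeasurableSpace E› =
      MeasurableSpace.generateFrom (Set.range fun n => b n ⁻¹' {true}) := by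
    conv_lhs => rw [← MeasurableSpace.generateFrom_natGeneratingSequence E]
    congr 2
    ext n x
    simp [b, MeasurableSpace.mapNatBool]
  have hw : Measurable (Sum.elim (fun _ : E => lam⁻¹) fun _ : E => -rho⁻¹) :=
    measurable_const.sumElim measurable_const
  have hp : Measurable (Sum.elim id id : E ⊕ E → E) := measurable_id.sumElim measurable_id
  have hZ := hD.isScattered_disjSum hR hDR
  have hν : ((ENNReal.ofReal lam • μ).map Sum.inl + (ENNReal.ofReal rho • μ).map Sum.inr).map
      (Sum.elim id id : E ⊕ E → E) = (lam.toNNReal + rho.toNNReal) • μ := by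
    rw [Measure.map_add _ _ hp, Measure.map_map hp measurable_inl,
      Measure.map_map hp measurable_inr, Sum.elim_comp_inl, Sum.elim_comp_inr, Measure.map_id,
      Measure.map_id, add_smul]
    rfl
  have hH : ∀ z, ‖Sum.elim (fun _ : E => lam⁻¹) (fun _ : E => -rho⁻¹) z‖ₑ ≤
      (‖lam⁻¹‖₊ + ‖rho⁻¹‖₊ : NNReal) := by
    rintro (z | z) <;> simp only [Sum.elim_inl, Sum.elim_inr, enorm_eq_nnnorm, nnnorm_neg,
      ENNReal.coe_le_coe]
    · exact le_self_add
    · exact le_add_self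
  exact (hD.isOrthogonalNoise_disjSum hlam hrho hR hDR).integral_mul_tupleIntegral
    (by positivity) hb hsep hgen hN
    (fun Φ hΦ => measurable_tupleIntegral hZ.measurable_count hw hp (measurable_sumDigits hb)
      (eq_of_sumDigits_eq hsep) hΦ)
    (fun Φ hΦ => hZ.lintegral_tupleIntegral_le hp (measurable_sumDigits hb)
      (eq_of_sumDigits_eq hsep) hH hν hΦ) hΦ hΦ2 hΨ hΨ2

lemma edgeEstimator_eq_tupleIntegral {d N : ℕ} (W : Set (EuclideanSpace ℝ (Fin d)))
    {Φ : (Fin N → EuclideanSpace ℝ (Fin d)) → ℝ}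
    (hΦ : ∀ (σ : Equiv.Perm (Fin N)) x, Φ (x ∘ σ) = Φ x) (lam rho : ℝ)
    (D R : Finset (EuclideanSpace ℝ (Fin d))) :
    edgeEstimator W Φ lam rho D R = 1 / kernelIntegral W Φ *
      tupleIntegral (Sum.elim (fun _ => lam⁻¹) fun _ => -rho⁻¹) (Sum.elim id id)
        (D.disjSum R) Φ := by
  rw [edgeEstimator, sum_tupleSum_eq_tupleIntegral hΦ]

end EdgeCorrection

end

/-! ### The covariance at finite rho and its limit -/

theorem theorem1 {d N : ℕ} (hN : 1 ≤ N)
    (W : Set (EuclideanSpace ℝ (Fin d))) (hW : MeasurableSet W) (hWfin : volume W ≠ ⊤)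
    (Φa Φb : (Fin N → EuclideanSpace ℝ (Fin d)) → ℝ)
    (hΦa : Measurable Φa) (hΦb : Measurable Φb)
    (hsyma : ∀ (σ : Equiv.Perm (Fin N)) (x : Fin N → EuclideanSpace ℝ (Fin d)),
      Φa (x ∘ σ) = Φa x)
    (hsymb : ∀ (σ : Equiv.Perm (Fin N)) (x : Fin N → EuclideanSpace ℝ (Fin d)),
      Φb (x ∘ σ) = Φb x)
    (hL2a : MemLp Φa 2 (windowMeasure W N)) (hL2b : MemLp Φb 2 (windowMeasure W N))
    (hSa : kernelIntegral W Φa ≠ 0) (hSb : kernelIntegral W Φb ≠ 0)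
    {Ω : Type*} [MeasurableSpace Ω] (P : Measure Ω) [IsProbabilityMeasure P]
    (lam : ℝ) (hlam : 0 < lam)
    (D : Ω → Finset (EuclideanSpace ℝ (Fin d)))
    (hD : IsPoissonProcess (ENNReal.ofReal lam • volume.restrict W) D P)
    (R : ℝ → Ω → Finset (EuclideanSpace ℝ (Fin d)))
    (hR : ∀ rho : ℝ, 0 < rho →
      IsPoissonProcess (ENNReal.ofReal rho • volume.restrict W) (R rho) P)
    (hDR : ∀ rho : ℝ, 0 < rho → Indep (processSigma D) (processSigma (R rho)) P) :
    -- for every finite `rho` the estimators are square integrable with mean zero,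
    -- and their covariance is the mean of their product
    (∀ rho : ℝ, 0 < rho →
      MemLp (fun ω => edgeEstimator W Φa lam rho (D ω) (R rho ω)) 2 P ∧
      MemLp (fun ω => edgeEstimator W Φb lam rho (D ω) (R rho ω)) 2 P ∧
      ∫ ω, edgeEstimator W Φa lam rho (D ω) (R rho ω) ∂P = 0 ∧
      ∫ ω, edgeEstimator W Φb lam rho (D ω) (R rho ω) ∂P = 0 ∧
      covariance (fun ω => edgeEstimator W Φa lam rho (D ω) (R rho ω))
          (fun ω => edgeEstimator W Φb lam rho (D ω) (R rho ω)) P =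
        ∫ ω, edgeEstimator W Φa lam rho (D ω) (R rho ω) *
          edgeEstimator W Φb lam rho (D ω) (R rho ω) ∂P) ∧
    -- the limit of the covariance
    Tendsto (fun rho : ℝ =>
        covariance (fun ω => edgeEstimator W Φa lam rho (D ω) (R rho ω))
          (fun ω => edgeEstimator W Φb lam rho (D ω) (R rho ω)) P)
      atTop
      (𝓝 ((∫ x, Φa x * Φb x ∂windowMeasure W N) * (N.factorial : ℝ) /
        (kernelIntegral W Φa * kernelIntegral W Φb * lam ^ N))) ∧
    -- the coefficients of the orders `lam ^ (-i)`, `i < N`, cancel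
    (∀ i : ℕ, ∑ j ∈ Finset.range (N + 1),
        (N.choose j : ℤ) * (j.choose i : ℤ) * (-1) ^ (N - j) = if i = N then 1 else 0) := by
  have hfinW : IsFiniteMeasure (volume.restrict W) :=
    ⟨by rw [Measure.restrict_apply_univ]; exact hWfin.lt_top⟩
  have key : ∀ rho : ℝ, 0 < rho →
      (MemLp (fun ω => edgeEstimator W Φa lam rho (D ω) (R rho ω)) 2 P ∧
      MemLp (fun ω => edgeEstimator W Φb lam rho (D ω) (R rho ω)) 2 P ∧
      ∫ ω, edgeEstimator W Φa lam rho (D ω) (R rho ω) ∂P = 0 ∧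
      ∫ ω, edgeEstimator W Φb lam rho (D ω) (R rho ω) ∂P = 0 ∧
      covariance (fun ω => edgeEstimator W Φa lam rho (D ω) (R rho ω))
          (fun ω => edgeEstimator W Φb lam rho (D ω) (R rho ω)) P =
        ∫ ω, edgeEstimator W Φa lam rho (D ω) (R rho ω) *
          edgeEstimator W Φb lam rho (D ω) (R rho ω) ∂P) ∧
      covariance (fun ω => edgeEstimator W Φa lam rho (D ω) (R rho ω))
          (fun ω => edgeEstimator W Φb lam rho (D ω) (R rho ω)) P =
        (lam⁻¹ + rho⁻¹) ^ N * ((∫ x, Φa x * Φb x ∂windowMeasure W N) * (N.factorial : ℝ) /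
          (kernelIntegral W Φa * kernelIntegral W Φb)) := by
    intro rho hrho
    obtain ⟨ha2, ha0, hab⟩ := hD.tupleIntegral_disjSum hlam hrho (hR rho hrho) (hDR rho hrho) hN
      hΦa hL2a hΦb hL2b
    obtain ⟨hb2, hb0, -⟩ := hD.tupleIntegral_disjSum hlam hrho (hR rho hrho) (hDR rho hrho) hN
      hΦb hL2b hΦa hL2a
    simp only [edgeEstimator_eq_tupleIntegral W hsyma, edgeEstimator_eq_tupleIntegral W hsymb]
    have ha := ha2.const_mul (1 / kernelIntegral W Φa)
    have hb := hb2.const_mul (1 / kernelIntegral W Φb)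
    have hcov := covariance_eq_sub ha hb
    simp only [Pi.mul_apply, integral_const_mul, ha0, hb0, mul_zero, sub_zero] at hcov
    refine ⟨⟨ha, hb, by rw [integral_const_mul, ha0, mul_zero],
      by rw [integral_const_mul, hb0, mul_zero], hcov⟩, ?_⟩
    rw [hcov]
    simp only [mul_mul_mul_comm (1 / kernelIntegral W Φa)]
    rw [integral_const_mul, hab]
    -- Symmetry of Φb makes all N! terms of the isometry equal.
    simp only [hsymb, Finset.sum_const, Finset.card_univ, Fintype.card_perm, Fintype.card_fin,
      nsmul_eq_mul, windowMeasure]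
    field_simp
  refine ⟨fun rho hrho => (key rho hrho).1, ?_, sum_choose_mul_choose_mul_neg_one_pow N⟩
  have hlim : Tendsto (fun rho : ℝ => (lam⁻¹ + rho⁻¹) ^ N *
      ((∫ x, Φa x * Φb x ∂windowMeasure W N) * (N.factorial : ℝ) /
        (kernelIntegral W Φa * kernelIntegral W Φb))) atTop
      (𝓝 ((lam⁻¹ + 0) ^ N * ((∫ x, Φa x * Φb x ∂windowMeasure W N) * (N.factorial : ℝ) /
        (kernelIntegral W Φa * kernelIntegral W Φb)))) :=
    ((tendsto_inv_atTop_zero.const_add _).pow N).mul_const _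
  have heq : (lam⁻¹ + 0) ^ N * ((∫ x, Φa x * Φb x ∂windowMeasure W N) * (N.factorial : ℝ) /
        (kernelIntegral W Φa * kernelIntegral W Φb)) =
      (∫ x, Φa x * Φb x ∂windowMeasure W N) * (N.factorial : ℝ) /
        (kernelIntegral W Φa * kernelIntegral W Φb * lam ^ N) := by
    rw [add_zero, inv_pow]
    field_simp
  rw [heq] at hlim
  refine hlim.congr' ?_
  filter_upwards [eventually_gt_atTop 0] with rho hrho
  exact (key rho hrho).2.symm
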